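/- **Setting.** Let $\mathcal X_1,\mathcal X_2,\mathcal X_3,\mathcal Y_1,\mathcal Y_2,\mathcal Y_3$ be non-empty standard Borel spaces (for instance finite or Euclidean) and let $P_{Y_1Y_2Y_3|X_1X_2X_3}$ be a transition probability from $\mathcal X_1\times\mathcal X_2\times\mathcal X_3$ to $\mathcal Y_1\times\mathcal Y_2\times\mathcal Y_3$. The general memoryless $3$-user cognitive interference channel with cognitive-only message sharing (3-CIFC-CoMS) uses this channel $N$ times without memory, so that given the input block the output triples at different times are independent. A code of block length $N$ and rates $R_1,R_2,R_3\ge 0$ (in bits per channel use) consists of mutually independent messages $W_i$, uniform on the set $[1:2^{NR_i}]$ of integers from $1$ to $2^{NR_i}$; encoders $X_1^N=f_1(W_1)$, $X_2^N=f_2(W_2)$, $X_3^N=f_3(W_1,W_2,W_3)$; and (measurable) decoders $\widehat W_i=g_i(Y_i^N)$, $i=1,2,3$. The capacity region is the set of all $(R_1,R_2,R_3)$ for which there is a sequence of such codes, one for each $N$, with $\max_{i}\mathbb P[\widehat W_i\ne W_i]\to 0$ as $N\to\infty$. The sum-capacity $C_\Sigma\in[0,\infty]$ is the supremum of $R_1+R_2+R_3$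 over the capacity region. For a joint input distribution $P=P_{X_1X_2X_3}$ (not necessarily a product), let $(X_1,X_2,X_3,Y_1,Y_2,Y_3)\sim P_{X_1X_2X_3}P_{Y_1Y_2Y_3|X_1X_2X_3}$ and define, with (conditional) mutual informations in bits, $$a(P):=\min\{I(Y_3;X_3|X_1,X_2,Y_1),\,I(Y_3;X_3|X_1,X_2,Y_2)\}+I(Y_1;X_1,X_3|X_2)+I(Y_2;X_2,X_3|X_1),$$ $$b(P):=\min\{I(Y_1;X_1,X_2,X_3)+I(Y_2;X_2,X_3|X_1,Y_1),\; I(Y_1;X_1,X_3|X_2,Y_2)+I(Y_2;X_1,X_2,X_3)\}+I(Y_3;X_3|X_2,Y_2,X_1,Y_1).$$ **Corollary.** The sum-capacity of the general memoryless 3-CIFC-CoMS satisfies $$C_\Sigma\le\sup_{P_{X_1X_2X_3}}\min\big(a(P),b(P)\big).$$ If moreover the input alphabets $\mathcal X_1,\mathcal X_2,\mathcal X_3$ are finite, then there is a single input distribution $P_{X_1X_2X_3}$ with $C_\Sigma\le\min\big(a(P),b(P)\big)$. -/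

import Mathlib

open MeasureTheory ProbabilityTheory InformationTheory Filter Topology
open scoped ENNReal

noncomputable section

namespace CoMS

section Information

variable {Ω α β γ : Type*} [MeasurableSpace Ω] [MeasurableSpace α] [MeasurableSpace β]
  [MeasurableSpace γ]

/-- Mutual information `I(U; V)` in bits: the Kullback-Leibler divergence of the joint law of
`(U, V)` from the product of the marginal laws. -/
def mutualInfo (U : Ω → α) (V : Ω → β) (μ : Measure Ω) : ℝ≥0∞ :=
  klDiv (μ.map fun ω => (U ω, V ω)) ((μ.map U).prod (μ.map V)) / ENNReal.ofReal (Real.log 2)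

/-- Conditional mutual information `I(U; V | Z)` in bits: the Kullback-Leibler divergence of the
joint law `P_{Z,U,V}` from `P_Z P_{U|Z} P_{V|Z}`, under which `U` and `V` are conditionally
independent given `Z`. -/
def condMutualInfo [StandardBorelSpace α] [Nonempty α] [StandardBorelSpace β] [Nonempty β]
    (U : Ω → α) (V : Ω → β) (Z : Ω → γ) (μ : Measure Ω) [IsFiniteMeasure μ] : ℝ≥0∞ :=
  klDiv (μ.map fun ω => (Z ω, (U ω, V ω)))
      (μ.map Z ⊗ₘ (condDistrib U Z μ ×ₖ condDistrib V Z μ)) /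
    ENNReal.ofReal (Real.log 2)

end Information

section Coding

variable (X₁ X₂ X₃ Y₁ Y₂ Y₃ : Type*) [MeasurableSpace Y₁] [MeasurableSpace Y₂]
  [MeasurableSpace Y₃]

/-- A block code of length `N` for the 3-user cognitive interference channel with cognitive-only
message sharing, with `Mᵢ` messages for user `i`. The primary encoders 1 and 2 know only their own
message, the cognitive encoder 3 knows all three messages, and decoder `i` sees only the `i`-th
output sequence. -/
structure Code (N M₁ M₂ M₃ : ℕ) where
  enc₁ : Fin M₁ → Fin N → X₁
  enc₂ : Fin M₂ → Fin N → X₂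
  enc₃ : Fin M₁ × Fin M₂ × Fin M₃ → Fin N → X₃
  dec₁ : (Fin N → Y₁) → Fin M₁
  dec₂ : (Fin N → Y₂) → Fin M₂
  dec₃ : (Fin N → Y₃) → Fin M₃
  measurable_dec₁ : Measurable dec₁
  measurable_dec₂ : Measurable dec₂
  measurable_dec₃ : Measurable dec₃

end Coding

section Channel

variable {X₁ X₂ X₃ Y₁ Y₂ Y₃ : Type*} [MeasurableSpace X₁] [MeasurableSpace X₂]
  [MeasurableSpace X₃] [MeasurableSpace Y₁] [MeasurableSpace Y₂] [MeasurableSpace Y₃]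

namespace Code

variable {N M₁ M₂ M₃ : ℕ}

/-- The three inputs at time `t` when the messages are `w`. -/
def input (c : Code X₁ X₂ X₃ Y₁ Y₂ Y₃ N M₁ M₂ M₃) (w : Fin M₁ × Fin M₂ × Fin M₃) (t : Fin N) :
    X₁ × X₂ × X₃ :=
  (c.enc₁ w.1 t, c.enc₂ w.2.1 t, c.enc₃ w t)

/-- The law of the output block when the messages are `w` and the channel `W` is used without
memory: the product over time of the single-letter output laws. -/
def outputLaw (c : Code X₁ X₂ X₃ Y₁ Y₂ Y₃ N M₁ M₂ M₃) (W : Kernel (X₁ × X₂ × X₃) (Y₁ × Y₂ × Y₃))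
    (w : Fin M₁ × Fin M₂ × Fin M₃) : Measure (Fin N → Y₁ × Y₂ × Y₃) :=
  Measure.pi fun t => W (c.input w t)

/-- Error probability of user 1, for independent, uniformly distributed messages. -/
def errorProb₁ (c : Code X₁ X₂ X₃ Y₁ Y₂ Y₃ N M₁ M₂ M₃)
    (W : Kernel (X₁ × X₂ × X₃) (Y₁ × Y₂ × Y₃)) : ℝ≥0∞ :=
  (∑ w, c.outputLaw W w {y | c.dec₁ (fun t => (y t).1) ≠ w.1}) / (M₁ * M₂ * M₃)

/-- Error probability of user 2, for independent, uniformly distributed messages. -/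
def errorProb₂ (c : Code X₁ X₂ X₃ Y₁ Y₂ Y₃ N M₁ M₂ M₃)
    (W : Kernel (X₁ × X₂ × X₃) (Y₁ × Y₂ × Y₃)) : ℝ≥0∞ :=
  (∑ w, c.outputLaw W w {y | c.dec₂ (fun t => (y t).2.1) ≠ w.2.1}) / (M₁ * M₂ * M₃)

/-- Error probability of user 3, for independent, uniformly distributed messages. -/
def errorProb₃ (c : Code X₁ X₂ X₃ Y₁ Y₂ Y₃ N M₁ M₂ M₃)
    (W : Kernel (X₁ × X₂ × X₃) (Y₁ × Y₂ × Y₃)) : ℝ≥0∞ :=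
  (∑ w, c.outputLaw W w {y | c.dec₃ (fun t => (y t).2.2) ≠ w.2.2}) / (M₁ * M₂ * M₃)

/-- The largest of the three error probabilities. -/
def errorProb (c : Code X₁ X₂ X₃ Y₁ Y₂ Y₃ N M₁ M₂ M₃)
    (W : Kernel (X₁ × X₂ × X₃) (Y₁ × Y₂ × Y₃)) : ℝ≥0∞ :=
  max (c.errorProb₁ W) (max (c.errorProb₂ W) (c.errorProb₃ W))

end Code

/-- The number of integers in `[1 : 2 ^ (N R)]`. -/
def numMessages (N : ℕ) (R : ℝ) : ℕ := ⌊(2 : ℝ) ^ ((N : ℝ) * R)⌋₊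

/-- The capacity region: the nonnegative rate triples (in bits per channel use) for which some
sequence of codes, one for each block length, has vanishing error probability. -/
def capacityRegion (W : Kernel (X₁ × X₂ × X₃) (Y₁ × Y₂ × Y₃)) : Set (ℝ × ℝ × ℝ) :=
  {R | 0 ≤ R.1 ∧ 0 ≤ R.2.1 ∧ 0 ≤ R.2.2 ∧
    ∃ c : ∀ N : ℕ, Code X₁ X₂ X₃ Y₁ Y₂ Y₃ N
        (numMessages N R.1) (numMessages N R.2.1) (numMessages N R.2.2),
      Tendsto (fun N => (c N).errorProb W) atTop (𝓝 0)}

/-- The sum-capacity: the supremum of `R₁ + R₂ + R₃` over the capacity region. -/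
def sumCapacity (W : Kernel (X₁ × X₂ × X₃) (Y₁ × Y₂ × Y₃)) : ℝ≥0∞ :=
  ⨆ R ∈ capacityRegion W, ENNReal.ofReal (R.1 + R.2.1 + R.2.2)

/-- The joint law of inputs and outputs for input distribution `P`. -/
abbrev jointLaw (W : Kernel (X₁ × X₂ × X₃) (Y₁ × Y₂ × Y₃)) (P : ProbabilityMeasure (X₁ × X₂ × X₃)) :
    Measure ((X₁ × X₂ × X₃) × (Y₁ × Y₂ × Y₃)) :=
  (P : Measure (X₁ × X₂ × X₃)) ⊗ₘ W

variable [StandardBorelSpace X₁] [StandardBorelSpace X₂] [StandardBorelSpace X₃]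
  [StandardBorelSpace Y₁] [StandardBorelSpace Y₂] [StandardBorelSpace Y₃]
  [Nonempty X₁] [Nonempty X₂] [Nonempty X₃] [Nonempty Y₁] [Nonempty Y₂] [Nonempty Y₃]

/-- `min {I(Y₃; X₃ | X₁, X₂, Y₁), I(Y₃; X₃ | X₁, X₂, Y₂)} + I(Y₁; X₁, X₃ | X₂)
+ I(Y₂; X₂, X₃ | X₁)`. -/
def boundA (W : Kernel (X₁ × X₂ × X₃) (Y₁ × Y₂ × Y₃)) [IsMarkovKernel W]
    (P : ProbabilityMeasure (X₁ × X₂ × X₃)) : ℝ≥0∞ :=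
  min
      (condMutualInfo (fun ω => ω.2.2.2) (fun ω => ω.1.2.2)
        (fun ω => (ω.1.1, ω.1.2.1, ω.2.1)) (jointLaw W P))
      (condMutualInfo (fun ω => ω.2.2.2) (fun ω => ω.1.2.2)
        (fun ω => (ω.1.1, ω.1.2.1, ω.2.2.1)) (jointLaw W P))
    + condMutualInfo (fun ω => ω.2.1) (fun ω => (ω.1.1, ω.1.2.2))
        (fun ω => ω.1.2.1) (jointLaw W P)
    + condMutualInfo (fun ω => ω.2.2.1) (fun ω => (ω.1.2.1, ω.1.2.2))
        (fun ω => ω.1.1) (jointLaw W P)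

/-- `min {I(Y₁; X₁, X₂, X₃) + I(Y₂; X₂, X₃ | X₁, Y₁), I(Y₁; X₁, X₃ | X₂, Y₂) + I(Y₂; X₁, X₂, X₃)}
+ I(Y₃; X₃ | X₂, Y₂, X₁, Y₁)`. -/
def boundB (W : Kernel (X₁ × X₂ × X₃) (Y₁ × Y₂ × Y₃)) [IsMarkovKernel W]
    (P : ProbabilityMeasure (X₁ × X₂ × X₃)) : ℝ≥0∞ :=
  min
      (mutualInfo (fun ω => ω.2.1)
          (fun ω => (ω.1.1, ω.1.2.1, ω.1.2.2)) (jointLaw W P)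
        + condMutualInfo (fun ω => ω.2.2.1)
            (fun ω => (ω.1.2.1, ω.1.2.2))
            (fun ω => (ω.1.1, ω.2.1)) (jointLaw W P))
      (condMutualInfo (fun ω => ω.2.1)
            (fun ω => (ω.1.1, ω.1.2.2))
            (fun ω => (ω.1.2.1, ω.2.2.1)) (jointLaw W P)
        + mutualInfo (fun ω => ω.2.2.1)
            (fun ω => (ω.1.1, ω.1.2.1, ω.1.2.2)) (jointLaw W P))
    + condMutualInfo (fun ω => ω.2.2.2) (fun ω => ω.1.2.2)
        (fun ω => (ω.1.2.1, ω.2.2.1, ω.1.1, ω.2.1)) (jointLaw W P)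

end Channel

end CoMS

end

/-! The converse is a change of measure. The channel is compared with fictitious memoryless channels
`Q` that generate the outputs of some users one after another; each output sees only the earlier
outputs and those inputs that carry neither its own message nor a message decoded later. Under such
a `Q` the `M` possible values of these messages are guessed correctly with average probability at
most `1 / M`, whereas under the true channel a good code is almost always right. By
`ofReal_mul_measure_le_klDiv_add` this forces a divergence of about `log M`, and for product laws
the divergence is `N` times a single-letter divergence averaged over the empirical law `P` of the
inputs, taken over messages and time (`ofReal_log_le_condDiv`).

The law `P` depends on the code alone, so one `P` serves every `Q` at once; this is what
`IsDivergenceBound` records. Only afterwards is `Q` chosen, as the conditional output laws under `P`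
itself, and the chain rule turns the divergences into the mutual informations of `boundA` (orders 1,
3 plus 2, and 2, 3 plus 1) and of `boundB` (orders 1, 2, 3 and 2, 1, 3).

For finite inputs a maximizing `P` comes from compactness of the simplex. For fixed `Q` the averaged
divergence is linear in `P`, hence continuous as soon as its values are finite; a small perturbation
of `Q` inside its family achieves this (`Dominable`). No semicontinuity of mutual information is
needed. -/

namespace CoMS

/-! ### Kullback-Leibler divergence: change of measure, products, disintegration. -/

section Divergence

variable {α β : Type*} [MeasurableSpace α] [MeasurableSpace β]

/-- A change-of-measure bound: an event that is likely under `μ` and unlikely under `ν` forces a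
large divergence. -/
lemma ofReal_mul_measure_le_klDiv_add (μ ν : Measure α) [IsFiniteMeasure μ] [IsFiniteMeasure ν]
    {A : Set α} (hA : MeasurableSet A) (L : ℝ) :
    ENNReal.ofReal L * μ A ≤ klDiv μ ν + ENNReal.ofReal (Real.exp L) * ν A := by
  by_cases h : μ ≪ ν
  swap
  · simp [klDiv_of_not_ac h]
  -- Fenchel-Young inequality: the convex conjugate of `klFun` at `L` is `exp L - 1`, and the `-1`
  -- is given away.
  have key : ∀ r : ℝ, 0 ≤ r → L * r ≤ klFun r + Real.exp L := by
    intro r hr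
    rcases hr.eq_or_lt with rfl | hr
    · simp [klFun_zero]; positivity
    have h1 := Real.add_one_le_exp (L - Real.log r)
    rw [Real.exp_sub, Real.exp_log hr, le_div_iff₀ hr] at h1
    rw [klFun_apply]
    nlinarith
  have hμA : μ A = ∫⁻ x, A.indicator (fun x => μ.rnDeriv ν x) x ∂ν := by
    rw [lintegral_indicator hA, Measure.setLIntegral_rnDeriv h]
  rw [klDiv_eq_lintegral_klFun_of_ac h, hμA,
    ← lintegral_const_mul _ ((Measure.measurable_rnDeriv μ ν).indicator hA),
    ← lintegral_indicator_const hA, ← lintegral_add_left (by fun_prop)]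
  refine lintegral_mono_ae ?_
  filter_upwards [μ.rnDeriv_lt_top ν] with x hx
  by_cases hxA : x ∈ A
  · simp only [hxA, Set.indicator_of_mem]
    rw [← ENNReal.ofReal_add (klFun_nonneg ENNReal.toReal_nonneg) (Real.exp_pos _).le]
    conv_lhs => rw [← ENNReal.ofReal_toReal hx.ne]
    rw [← ENNReal.ofReal_mul' ENNReal.toReal_nonneg]
    exact ENNReal.ofReal_le_ofReal (key _ ENNReal.toReal_nonneg)
  · simp [hxA]

/-- Replacing the reference measure by one that dominates a multiple of it costs at most the
logarithm of the factor. -/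
lemma klDiv_le_add_of_smul_le (μ ν ν' : Measure α) [IsProbabilityMeasure μ]
    [IsProbabilityMeasure ν] [IsProbabilityMeasure ν'] {η : ℝ} (hη : 0 ≤ η)
    (h : ENNReal.ofReal (Real.exp (-η)) • ν ≤ ν') :
    klDiv μ ν' ≤ klDiv μ ν + ENNReal.ofReal η := by
  by_cases hac : μ ≪ ν
  swap
  · simp [klDiv_of_not_ac hac]
  have hc0 : ENNReal.ofReal (Real.exp (-η)) ≠ 0 := by simp [Real.exp_pos]
  have hνν' : ν ≪ ν' := by
    refine Measure.AbsolutelyContinuous.mk fun s _ hs => ?_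
    have := h s
    simpa [hs, Real.exp_pos, hc0, Real.exp_pos _ |>.not_ge] using this
  have hac' := hac.trans hνν'
  have hg : ν.rnDeriv ν' ≤ᵐ[ν'] fun _ => ENNReal.ofReal (Real.exp η) := by
    refine ae_le_of_forall_setLIntegral_le_of_sigmaFinite (by fun_prop) fun s hs _ => ?_
    rw [Measure.setLIntegral_rnDeriv hνν', setLIntegral_const]
    have h1 := h s
    simp only [Measure.smul_apply, smul_eq_mul] at h1
    calc ν s = ENNReal.ofReal (Real.exp η) * (ENNReal.ofReal (Real.exp (-η)) * ν s) := by
          rw [← mul_assoc, ← ENNReal.ofReal_mul (Real.exp_pos _).le, ← Real.exp_add]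
          simp
      _ ≤ _ := by gcongr
  have hmul := Measure.rnDeriv_mul_rnDeriv (κ := ν') hac
  have hfin : (1 : ℝ≥0∞) ≠ ∞ := by simp
  -- Let `f` be the density of `μ` in `ν` and `g` that of `ν` in `ν'`. Writing the added 1 as the
  -- integral of `g` on the left and of 1 on the right makes the integrands comparable pointwise:
  -- they differ by `f * g * (η - log g)`, which is nonnegative. Infinite divergences thus need no
  -- separate treatment.
  refine (ENNReal.add_le_add_iff_right hfin).1 ?_
  have e1 : (∫⁻ x, ν.rnDeriv ν' x ∂ν') = 1 := by
    rw [Measure.lintegral_rnDeriv hνν', measure_univ]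
  have e2 : klDiv μ ν
      = ∫⁻ x, ν.rnDeriv ν' x * ENNReal.ofReal (klFun (μ.rnDeriv ν x).toReal) ∂ν' := by
    rw [klDiv_eq_lintegral_klFun_of_ac hac,
      lintegral_rnDeriv_mul hνν' (by fun_prop)]
  have e3 : ENNReal.ofReal η = ∫⁻ x, μ.rnDeriv ν' x * ENNReal.ofReal η ∂ν' := by
    rw [lintegral_mul_const _ (by fun_prop), Measure.lintegral_rnDeriv hac', measure_univ, one_mul]
  have e4 : (1 : ℝ≥0∞) = ∫⁻ _, 1 ∂ν' := by simp
  calc klDiv μ ν' + 1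
      = ∫⁻ x, (ENNReal.ofReal (klFun (μ.rnDeriv ν' x).toReal) + ν.rnDeriv ν' x) ∂ν' := by
        rw [klDiv_eq_lintegral_klFun_of_ac hac', lintegral_add_left (by fun_prop), e1]
    _ ≤ ∫⁻ x, (ν.rnDeriv ν' x * ENNReal.ofReal (klFun (μ.rnDeriv ν x).toReal)
          + μ.rnDeriv ν' x * ENNReal.ofReal η + 1) ∂ν' := by
        refine lintegral_mono_ae ?_
        filter_upwards [hmul, hg, μ.rnDeriv_lt_top ν', ν.rnDeriv_lt_top ν'] with x h1 h2 h3 h4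
        rw [Pi.mul_apply] at h1
        rw [← h1] at h3 ⊢
        set g := ν.rnDeriv ν' x
        set f := μ.rnDeriv ν x
        obtain hg0 | hg0 := eq_or_ne g 0
        · simp [hg0, klFun_zero]
        have hf : f ≠ ∞ := by
          rintro hf
          rw [hf, ENNReal.top_mul hg0] at h3
          exact absurd h3 (by simp)
        lift g to NNReal using h4.ne with g'
        lift f to NNReal using hf with f'
        have hg' : (g' : ℝ) ≤ Real.exp η := by
          have := ENNReal.toReal_mono ENNReal.ofReal_ne_top h2
          rwa [ENNReal.toReal_ofReal (Real.exp_pos _).le] at this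
        have hgp : 0 < (g' : ℝ) := by
          have : g' ≠ 0 := by simpa using hg0
          positivity
        have e : ∀ r : NNReal, (r : ℝ≥0∞) = ENNReal.ofReal r := fun r => by simp
        have hfn : 0 ≤ klFun (f' : ℝ) := klFun_nonneg f'.2
        have hfn' : 0 ≤ klFun ((f' : ℝ) * g') := klFun_nonneg (by positivity)
        rw [ENNReal.toReal_mul]
        simp only [ENNReal.coe_toReal]
        rw [e g', e f', ← ENNReal.ofReal_add hfn' hgp.le,
          ← ENNReal.ofReal_mul (by positivity), ← ENNReal.ofReal_mul (by positivity),
          ← ENNReal.ofReal_mul (by positivity), ← ENNReal.ofReal_add (by positivity) (by positivity),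
          ← ENNReal.ofReal_one, ← ENNReal.ofReal_add (by positivity) (by positivity)]
        refine ENNReal.ofReal_le_ofReal ?_
        have hlog : Real.log g' ≤ η := (Real.log_le_iff_le_exp hgp).2 hg'
        rcases f'.2.eq_or_lt with hf0 | hf0
        · have : (f' : ℝ) = 0 := hf0.symm
          simp [this, klFun_zero]; linarith
        · have hf0' : (0 : ℝ) < f' := hf0
          rw [klFun_apply, klFun_apply, Real.log_mul hf0'.ne' hgp.ne']
          have := mul_le_mul_of_nonneg_left hlog (mul_pos hf0' hgp).le
          linarith
    _ = klDiv μ ν + ENNReal.ofReal η + 1 := by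
        rw [lintegral_add_right _ (by fun_prop), lintegral_add_right _ (by fun_prop), ← e2, ← e3,
          ← e4]

/-- Data processing, applied to `e` and to its inverse. -/
lemma klDiv_map_measurableEquiv (e : α ≃ᵐ β) (μ ν : Measure α) [IsFiniteMeasure μ]
    [IsFiniteMeasure ν] : klDiv (μ.map e) (ν.map e) = klDiv μ ν := by
  refine le_antisymm (klDiv_map_le μ ν e.measurable) ?_
  have := klDiv_map_le (μ.map e) (ν.map e) e.symm.measurable
  simpa using this

lemma klDiv_prod (μ μ' : Measure α) (ν ν' : Measure β) [IsProbabilityMeasure μ]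
    [IsProbabilityMeasure μ'] [IsProbabilityMeasure ν] [IsProbabilityMeasure ν'] :
    klDiv (μ.prod ν) (μ'.prod ν') = klDiv μ μ' + klDiv ν ν' := by
  have h : klDiv (μ.prod ν) (μ.prod ν') = klDiv ν ν' := by
    rw [← klDiv_map_measurableEquiv MeasurableEquiv.prodComm]
    simp only [MeasurableEquiv.prodComm, MeasurableEquiv.coe_mk, Equiv.coe_prodComm,
      Measure.prod_swap]
    rw [← Measure.compProd_const, ← Measure.compProd_const, klDiv_compProd_left]
  rw [← h, ← Measure.compProd_const, ← Measure.compProd_const, ← Measure.compProd_const,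
    klDiv_compProd_eq_add]

lemma klDiv_pi {n : ℕ} (μ ν : Fin n → Measure α) [∀ i, IsProbabilityMeasure (μ i)]
    [∀ i, IsProbabilityMeasure (ν i)] :
    klDiv (Measure.pi μ) (Measure.pi ν) = ∑ i, klDiv (μ i) (ν i) := by
  induction n with
  | zero => simp [Measure.pi_of_empty _ (fun i : Fin 0 => i.elim0)]
  | succ n ih =>
    rw [← klDiv_map_measurableEquiv (MeasurableEquiv.piFinSuccAbove (fun _ => α) 0),
      (measurePreserving_piFinSuccAbove μ 0).map_eq, (measurePreserving_piFinSuccAbove ν 0).map_eq,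
      klDiv_prod, ih, Fin.sum_univ_succ]
    simp

/-- The averaged divergence of two kernels. -/
noncomputable def condDiv (P : Measure α) (K Q : Kernel α β) : ℝ≥0∞ :=
  ∫⁻ x, klDiv (K x) (Q x) ∂P

/-- The density of one composition in the other is the kernel derivative, so the divergence of the
compositions disintegrates over `P`. Without absolute continuity the right side is infinite. -/
lemma condDiv_le_klDiv_compProd [MeasurableSpace.CountableOrCountablyGenerated α β]
    (P : Measure α) [IsProbabilityMeasure P]
    (K Q : Kernel α β) [IsMarkovKernel K] [IsMarkovKernel Q] :
    condDiv P K Q ≤ klDiv (P ⊗ₘ K) (P ⊗ₘ Q) := by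
  by_cases h : P ⊗ₘ K ≪ P ⊗ₘ Q
  swap
  · simp [klDiv_of_not_ac h]
  have hae : ∀ᵐ x ∂P, K x ≪ Q x := Measure.absolutelyContinuous_compProd_right_iff.1 h
  have hm : Measurable (fun p : α × β => K.rnDeriv Q p.1 p.2) := Kernel.measurable_rnDeriv K Q
  have hK : K =ᵐ[P] Q.withDensity (K.rnDeriv Q) := by
    filter_upwards [hae] with x hx
    rw [Kernel.withDensity_rnDeriv_eq hx]
  have hden : P ⊗ₘ K = (P ⊗ₘ Q).withDensity fun p => K.rnDeriv Q p.1 p.2 := by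
    rw [Measure.compProd_congr hK, Measure.compProd_withDensity hm]
  have hrn : (P ⊗ₘ K).rnDeriv (P ⊗ₘ Q) =ᵐ[P ⊗ₘ Q] fun p => K.rnDeriv Q p.1 p.2 := by
    rw [hden]
    exact Measure.rnDeriv_withDensity _ hm
  rw [klDiv_eq_lintegral_klFun_of_ac h, condDiv,
    lintegral_congr_ae (hrn.mono fun p hp => by rw [hp]),
    Measure.lintegral_compProd (by fun_prop)]
  refine lintegral_mono_ae ?_
  filter_upwards [hae] with x hx
  rw [klDiv_eq_lintegral_klFun_of_ac hx]
  refine (lintegral_congr_ae ?_).le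
  filter_upwards [Kernel.rnDeriv_eq_rnDeriv_measure (κ := K) (η := Q) (a := x)] with y hy
  rw [hy]

end Divergence

/-! ### Families of alternative channels. -/

section Alternatives

variable {α β γ δ τ Ω : Type*} [MeasurableSpace α] [MeasurableSpace β] [MeasurableSpace γ]
  [MeasurableSpace δ] [MeasurableSpace τ] [MeasurableSpace Ω]

/-- The Markov kernels from `τ` to `α` whose value at `x` is a measurable function of `f x`. -/
def kernelsThrough (f : τ → γ) (α : Type*) [MeasurableSpace α] : Set (Kernel τ α) :=
  {Q | ∃ q : Kernel γ α, IsMarkovKernel q ∧ ∀ x, Q x = q (f x)}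

/-- The sequential kernels: a first output drawn from a kernel in `S`, then a second output whose
law depends on the input and the first output only through `g`. -/
def sequentialKernels (S : Set (Kernel τ α)) (g : τ × α → δ) (β : Type*) [MeasurableSpace β] :
    Set (Kernel τ (α × β)) :=
  {Q | ∃ Q₀ ∈ S, ∃ Q₁ ∈ kernelsThrough g β, Q = Q₀ ⊗ₖ Q₁}

lemma isMarkovKernel_of_mem_kernelsThrough {f : τ → γ} {Q : Kernel τ α}
    (hQ : Q ∈ kernelsThrough f α) : IsMarkovKernel Q := by
  obtain ⟨q, hq, h⟩ := hQ
  exact ⟨fun x => by rw [h]; infer_instance⟩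

lemma isMarkovKernel_of_mem_sequentialKernels {S : Set (Kernel τ α)}
    (hS : ∀ Q ∈ S, IsMarkovKernel Q) {g : τ × α → δ} {Q : Kernel τ (α × β)}
    (hQ : Q ∈ sequentialKernels S g β) : IsMarkovKernel Q := by
  obtain ⟨Q₀, h₀, Q₁, h₁, rfl⟩ := hQ
  have := hS _ h₀
  have := isMarkovKernel_of_mem_kernelsThrough h₁
  infer_instance

lemma apply_eq_of_mem_kernelsThrough {f : τ → γ} {Q : Kernel τ α}
    (hQ : Q ∈ kernelsThrough f α) {x x' : τ} (h : f x = f x') : Q x = Q x' := by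
  obtain ⟨q, -, hq⟩ := hQ
  rw [hq, hq, h]

lemma compProd_apply_congr {Q₀ : Kernel τ α} {Q₁ : Kernel (τ × α) β} [IsMarkovKernel Q₀]
    [IsMarkovKernel Q₁] {x x' : τ} (h₀ : Q₀ x = Q₀ x') (h₁ : ∀ a, Q₁ (x, a) = Q₁ (x', a)) :
    (Q₀ ⊗ₖ Q₁) x = (Q₀ ⊗ₖ Q₁) x' := by
  ext s hs
  simp_rw [Kernel.compProd_apply hs, h₀, h₁]

lemma compProd_map_fst_apply (Q₀ : Kernel τ α) (Q₁ : Kernel (τ × α) β) [IsMarkovKernel Q₀]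
    [IsMarkovKernel Q₁] (x : τ) : ((Q₀ ⊗ₖ Q₁) x).map Prod.fst = Q₀ x := by
  rw [← Kernel.map_apply _ measurable_fst, ← Kernel.fst_eq, Kernel.fst_compProd]

/-! ### Perturbing alternatives to make their divergences finite. -/

section Domination

/-- Every kernel of `S` can be perturbed within `S`, at an arbitrarily small multiplicative loss,
to dominate a multiple of any given law. -/
def Dominable (S : Set (Kernel τ α)) : Prop :=
  ∀ Q ∈ S, ∀ ν : Measure α, IsProbabilityMeasure ν → ∀ η : ℝ, 0 < η → ∃ Q' ∈ S, ∃ d : ℝ≥0∞, d ≠ 0 ∧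
    ∀ x, ENNReal.ofReal (Real.exp (-η)) • Q x ≤ Q' x ∧ d • ν ≤ Q' x

/-- Mix with weight `exp (-η)` on the given kernel and the rest on `κ`. Mixing before composing with
`f` keeps the result in the family. Letting `κ` vary with `f x` is what the second stage of a
sequential kernel requires. -/
lemma exists_kernelsThrough_dominating {f : τ → γ} (hf : Measurable f) {Q : Kernel τ α}
    (hQ : Q ∈ kernelsThrough f α) (κ : Kernel γ α) [IsMarkovKernel κ] {η : ℝ} (hη : 0 < η) :
    ∃ Q' ∈ kernelsThrough f α, ∃ d : ℝ≥0∞, d ≠ 0 ∧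
      ∀ x, ENNReal.ofReal (Real.exp (-η)) • Q x ≤ Q' x ∧ d • κ (f x) ≤ Q' x := by
  obtain ⟨q, hq, h⟩ := hQ
  set e := ENNReal.ofReal (Real.exp (-η)) with he
  have he1 : e < 1 := by
    rw [he, ENNReal.ofReal_lt_one, Real.exp_lt_one_iff]; linarith
  let q' : Kernel γ α :=
    { toFun := fun a => e • q a + (1 - e) • κ a
      measurable' := by
        refine Measure.measurable_of_measurable_coe _ fun s hs => ?_
        simp only [Measure.coe_add, Measure.coe_smul, Pi.add_apply, Pi.smul_apply, smul_eq_mul]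
        exact ((q.measurable_coe hs).const_mul _).add ((κ.measurable_coe hs).const_mul _) }
  have hq'_apply : ∀ a, q' a = e • q a + (1 - e) • κ a := fun _ => rfl
  have hq' : IsMarkovKernel q' := ⟨fun a => ⟨by
    simp only [hq'_apply, Measure.coe_add, Measure.coe_smul, Pi.add_apply, Pi.smul_apply,
      smul_eq_mul, measure_univ, mul_one]
    exact add_tsub_cancel_of_le he1.le⟩⟩
  refine ⟨q'.comap f hf, ⟨q', hq', fun x => rfl⟩, 1 - e, (tsub_pos_of_lt he1).ne', fun x => ?_⟩
  rw [Kernel.comap_apply, hq'_apply, h]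
  exact ⟨Measure.le_add_right le_rfl, Measure.le_add_left le_rfl⟩

lemma dominable_kernelsThrough {f : τ → γ} (hf : Measurable f) :
    Dominable (kernelsThrough f α) := by
  intro Q hQ ν hν η hη
  exact exists_kernelsThrough_dominating hf hQ (Kernel.const γ ν) hη

lemma smul_compProd_apply_le {c d : ℝ≥0∞} {Q₀ Q₀' : Kernel τ α} {Q₁ Q₁' : Kernel (τ × α) β}
    [IsMarkovKernel Q₀] [IsMarkovKernel Q₀'] [IsMarkovKernel Q₁] [IsMarkovKernel Q₁'] {x : τ}
    (h₀ : c • Q₀ x ≤ Q₀' x) (h₁ : ∀ a, d • Q₁ (x, a) ≤ Q₁' (x, a)) :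
    (c * d) • (Q₀ ⊗ₖ Q₁) x ≤ (Q₀' ⊗ₖ Q₁') x := by
  refine Measure.le_iff.2 fun s hs => ?_
  simp only [Measure.smul_apply, smul_eq_mul]
  have hm : Measurable fun a => Q₁ (x, a) (Prod.mk a ⁻¹' s) :=
    Kernel.measurable_kernel_prodMk_left' (η := Q₁) hs x
  rw [Kernel.compProd_apply hs, Kernel.compProd_apply hs, mul_assoc, ← lintegral_const_mul _ hm,
    ← smul_eq_mul, ← lintegral_smul_measure]
  exact lintegral_mono' h₀ fun a => h₁ a _

/-- Disintegrate `ν` and perturb the first stage towards its marginal, the second towards its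
conditional law, at cost `η / 2` each. The conditional law takes the first output as argument, so
`g` must retain that output; `r` reads it off. -/
lemma dominable_sequentialKernels [StandardBorelSpace β] [Nonempty β] {S : Set (Kernel τ α)}
    (hS : Dominable S) (hS' : ∀ Q ∈ S, IsMarkovKernel Q) {g : τ × α → δ} (hg : Measurable g)
    {r : δ → α} (hr : Measurable r) (hrg : ∀ p, r (g p) = p.2) :
    Dominable (sequentialKernels S g β) := by
  rintro Q ⟨Q₀, h₀, Q₁, h₁, rfl⟩ ν hν η hη
  obtain ⟨Q₀', h₀', d, hd, H₀⟩ := hS Q₀ h₀ ν.fst inferInstance (η / 2) (by linarith)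
  obtain ⟨Q₁', h₁', d', hd', H₁⟩ := exists_kernelsThrough_dominating hg h₁
    (ν.condKernel.comap r hr) (η := η / 2) (by linarith)
  have := hS' _ h₀
  have := hS' _ h₀'
  have := isMarkovKernel_of_mem_kernelsThrough h₁
  have := isMarkovKernel_of_mem_kernelsThrough h₁'
  refine ⟨Q₀' ⊗ₖ Q₁', ⟨Q₀', h₀', Q₁', h₁', rfl⟩, d * d', mul_ne_zero hd hd', fun x => ⟨?_, ?_⟩⟩
  · have : ENNReal.ofReal (Real.exp (-η))
        = ENNReal.ofReal (Real.exp (-(η / 2))) * ENNReal.ofReal (Real.exp (-(η / 2))) := by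
      rw [← ENNReal.ofReal_mul (Real.exp_pos _).le, ← Real.exp_add]
      ring_nf
    rw [this]
    exact smul_compProd_apply_le (H₀ x).1 fun a => (H₁ (x, a)).1
  · have hν' : (Kernel.const τ ν.fst ⊗ₖ ν.condKernel.comap Prod.snd measurable_snd) x = ν := by
      conv_rhs => rw [← ν.disintegrate ν.condKernel]
      ext s hs
      rw [Kernel.compProd_apply hs, Measure.compProd_apply hs]
      rfl
    conv_lhs => rw [← hν']
    refine smul_compProd_apply_le (H₀ x).2 fun a => ?_
    have := (H₁ (x, a)).2
    rwa [Kernel.comap_apply, hrg] at this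

/-- For finitely many inputs, kernels of a dominable family may be perturbed to have finite
divergence from a given kernel at every input. -/
lemma Dominable.exists_klDiv_ne_top [Finite τ] [Nonempty τ] {S : Set (Kernel τ α)}
    (hS : Dominable S) (hS' : ∀ Q ∈ S, IsMarkovKernel Q) (K : Kernel τ α) [IsMarkovKernel K]
    {Q : Kernel τ α} (hQ : Q ∈ S) {η : ℝ} (hη : 0 < η) :
    ∃ Q' ∈ S, ∀ x, klDiv (K x) (Q' x) ≠ ∞ ∧
      klDiv (K x) (Q' x) ≤ klDiv (K x) (Q x) + ENNReal.ofReal η := by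
  cases nonempty_fintype τ
  set n : ℝ≥0∞ := (Fintype.card τ : ℝ≥0∞)
  have hn : n ≠ 0 := by simp [n]
  have hn' : n ≠ ∞ := by simp [n]
  -- The uniform mixture dominates a multiple of each `K x`; finiteness of `τ` enters here.
  let ν : Measure α := n⁻¹ • ∑ x, K x
  have hν : IsProbabilityMeasure ν := ⟨by
    simp only [ν, Measure.smul_apply, Measure.finsetSum_apply, measure_univ, Finset.sum_const,
      Finset.card_univ, nsmul_eq_mul, mul_one, smul_eq_mul]
    exact ENNReal.inv_mul_cancel hn hn'⟩
  obtain ⟨Q', hQ', d, hd, H⟩ := hS Q hQ ν hν η hη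
  have := hS' _ hQ
  have := hS' _ hQ'
  refine ⟨Q', hQ', fun x => ⟨?_, klDiv_le_add_of_smul_le _ _ _ hη.le (H x).1⟩⟩
  have hle : (d * n⁻¹) • K x ≤ Q' x := by
    refine le_trans ?_ (H x).2
    rw [mul_smul]
    refine Measure.le_iff.2 fun s hs => ?_
    simp only [ν, Measure.smul_apply, smul_eq_mul, Measure.finsetSum_apply]
    gcongr
    exact Finset.single_le_sum (f := fun x => K x s) (fun _ _ => zero_le) (Finset.mem_univ x)
  have hd1 : d * n⁻¹ ≤ 1 := by simpa using hle Set.univ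
  have hd0 : d * n⁻¹ ≠ 0 := mul_ne_zero hd (by simp [hn'])
  have hdt : d * n⁻¹ ≠ ∞ := (hd1.trans_lt (by simp)).ne
  have hpos := ENNReal.toReal_pos hd0 hdt
  have hlog : Real.log (d * n⁻¹).toReal ≤ 0 :=
    Real.log_nonpos hpos.le (by simpa using ENNReal.toReal_mono (by simp) hd1)
  -- Starting from the zero divergence of `K x` from itself, domination by the factor `d / n` costs
  -- at most `-log (d / n)`, which is finite.
  have := klDiv_le_add_of_smul_le (K x) (K x) (Q' x) (η := -Real.log (d * n⁻¹).toReal)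
    (by linarith) (by rwa [neg_neg, Real.exp_log hpos, ENNReal.ofReal_toReal hdt])
  rw [klDiv_self, zero_add] at this
  exact (this.trans_lt ENNReal.ofReal_lt_top).ne

end Domination

/-! ### Mutual informations as divergences from alternatives. -/

section Information

variable (μ : Measure Ω) [IsProbabilityMeasure μ]

lemma log_two_ne_zero : ENNReal.ofReal (Real.log 2) ≠ 0 := by
  simp [Real.log_pos]

/-- The conditional law of `U` given `Z` is a kernel through `Z` whose divergence is the
conditional mutual information. -/
lemma exists_kernelsThrough_klDiv_le_condMutualInfo [StandardBorelSpace α] [Nonempty α]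
    [StandardBorelSpace β] [Nonempty β] {T : Ω → τ} {U : Ω → α} {V : Ω → β} {Z : Ω → γ}
    (hU : Measurable U) (hV : Measurable V) (hZ : Measurable Z)
    {f : τ → γ} (hf : Measurable f) {r : γ × β → τ} (hr : Measurable r)
    (hfr : ∀ p, f (r p) = p.1) (hT : ∀ ω, r (Z ω, V ω) = T ω) :
    ∃ Q ∈ kernelsThrough f α, klDiv (μ.map fun ω => (T ω, U ω)) (μ.map T ⊗ₘ Q)
      ≤ condMutualInfo U V Z μ * ENNReal.ofReal (Real.log 2) := by
  refine ⟨(condDistrib U Z μ).comap f hf, ⟨_, inferInstance, fun _ => rfl⟩, ?_⟩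
  rw [condMutualInfo, ENNReal.div_mul_cancel log_two_ne_zero ENNReal.ofReal_ne_top]
  have hT' : T = fun ω => r (Z ω, V ω) := funext fun ω => (hT ω).symm
  -- Data processing along this regrouping suffices. It sends the conditionally independent law to
  -- `μ.map T ⊗ₘ Q` because `f` recovers `Z` from `r (Z, V)`.
  have hg : Measurable fun p : γ × α × β => (r (p.1, p.2.2), p.2.1) := by fun_prop
  refine le_trans (le_of_eq ?_) (klDiv_map_le _ _ hg)
  congr 1
  · rw [Measure.map_map hg (by fun_prop), hT']
    rfl
  · have hT'' : μ.map T = (μ.map Z ⊗ₘ condDistrib V Z μ).map r := by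
      rw [compProd_map_condDistrib hV.aemeasurable, Measure.map_map hr (by fun_prop), hT']
      rfl
    rw [hT'']
    have : IsProbabilityMeasure (μ.map Z) := Measure.isProbabilityMeasure_map hZ.aemeasurable
    have : IsProbabilityMeasure ((μ.map Z ⊗ₘ condDistrib V Z μ).map r) :=
      Measure.isProbabilityMeasure_map hr.aemeasurable
    refine Measure.ext_of_lintegral _ fun F hF => ?_
    rw [lintegral_map hF hg, Measure.lintegral_compProd (by fun_prop),
      Measure.lintegral_compProd (by fun_prop), lintegral_map ?_ hr, Measure.lintegral_compProd]
    · refine lintegral_congr fun c => ?_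
      rw [Kernel.prod_apply, lintegral_prod_symm _ (by fun_prop)]
      simp only [Kernel.comap_apply, hfr]
    · exact (Measurable.lintegral_kernel_prod_right'
        (κ := (condDistrib U Z μ).comap f hf) hF).comp hr
    · exact Measurable.lintegral_kernel_prod_right'
        (κ := (condDistrib U Z μ).comap f hf) hF

lemma exists_kernelsThrough_klDiv_le_mutualInfo {T : Ω → τ} {U : Ω → α} {V : Ω → β}
    (hU : Measurable U) (hV : Measurable V) {r : β → τ} (hr : Measurable r)
    (hT : ∀ ω, r (V ω) = T ω) :
    ∃ Q ∈ kernelsThrough (fun _ : τ => ()) α,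
      klDiv (μ.map fun ω => (T ω, U ω)) (μ.map T ⊗ₘ Q)
        ≤ mutualInfo U V μ * ENNReal.ofReal (Real.log 2) := by
  have : IsProbabilityMeasure (μ.map U) := Measure.isProbabilityMeasure_map hU.aemeasurable
  have : IsProbabilityMeasure (μ.map V) := Measure.isProbabilityMeasure_map hV.aemeasurable
  refine ⟨Kernel.const τ (μ.map U), ⟨Kernel.const Unit (μ.map U), inferInstance, fun _ => rfl⟩, ?_⟩
  rw [mutualInfo, ENNReal.div_mul_cancel log_two_ne_zero ENNReal.ofReal_ne_top]
  have hT' : T = fun ω => r (V ω) := funext fun ω => (hT ω).symm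
  have hg : Measurable fun p : α × β => (r p.2, p.1) := by fun_prop
  refine le_trans (le_of_eq ?_) (klDiv_map_le _ _ hg)
  congr 1
  · rw [Measure.map_map hg (by fun_prop), hT']
    rfl
  · have hT'' : μ.map T = (μ.map V).map r := by
      rw [Measure.map_map hr hV, hT']
      rfl
    have : IsProbabilityMeasure ((μ.map V).map r) := Measure.isProbabilityMeasure_map hr.aemeasurable
    rw [hT'', Measure.compProd_const]
    have e : (fun p : α × β => (r p.2, p.1)) = Prod.map r id ∘ Prod.swap := rfl
    rw [e, ← Measure.map_map (by fun_prop) (by fun_prop), Measure.prod_swap,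
      ← Measure.map_prod_map _ _ hr measurable_id, Measure.map_id]

/-- Chain rule for the divergence: the second term compares the conditional law of `U₁` with the
second stage under the true law of `(T, U₀)`, as `h₁` does. -/
lemma klDiv_compProd_sequential_le [StandardBorelSpace β] [Nonempty β] {T : Ω → τ} {U₀ : Ω → α}
    {U₁ : Ω → β} (hT : Measurable T) (hU₀ : Measurable U₀) (hU₁ : Measurable U₁)
    {S : Set (Kernel τ α)} (hS : ∀ Q ∈ S, IsMarkovKernel Q) {g : τ × α → δ} {a b : ℝ≥0∞}
    (h₀ : ∃ Q ∈ S, klDiv (μ.map fun ω => (T ω, U₀ ω)) (μ.map T ⊗ₘ Q) ≤ a)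
    (h₁ : ∃ Q ∈ kernelsThrough g β, klDiv (μ.map fun ω => ((T ω, U₀ ω), U₁ ω))
      (μ.map (fun ω => (T ω, U₀ ω)) ⊗ₘ Q) ≤ b) :
    ∃ Q ∈ sequentialKernels S g β,
      klDiv (μ.map fun ω => (T ω, (U₀ ω, U₁ ω))) (μ.map T ⊗ₘ Q) ≤ a + b := by
  obtain ⟨Q₀, hQ₀, h₀⟩ := h₀
  obtain ⟨Q₁, hQ₁, h₁⟩ := h₁
  have := hS _ hQ₀
  have := isMarkovKernel_of_mem_kernelsThrough hQ₁
  have : IsProbabilityMeasure (μ.map T) := Measure.isProbabilityMeasure_map hT.aemeasurable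
  refine ⟨Q₀ ⊗ₖ Q₁, ⟨Q₀, hQ₀, Q₁, hQ₁, rfl⟩, ?_⟩
  rw [← Measure.compProd_assoc']
  have e : (μ.map fun ω => (T ω, (U₀ ω, U₁ ω)))
      = (μ.map fun ω => ((T ω, U₀ ω), U₁ ω)).map MeasurableEquiv.prodAssoc := by
    rw [Measure.map_map (by fun_prop) (by fun_prop)]
    rfl
  rw [e, klDiv_map_measurableEquiv, ← compProd_map_condDistrib (by fun_prop),
    klDiv_compProd_eq_add, compProd_map_condDistrib (by fun_prop)]
  exact add_le_add h₀ h₁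

end Information

end Alternatives

/-! ### Guessing probabilities under alternatives, and the single-letter bound. -/

section Testing

variable {τ α β ι σ : Type*} [MeasurableSpace τ] [MeasurableSpace α] [MeasurableSpace β]
  {N : ℕ}

lemma sum_measure_inter_fiber [Fintype ι] [MeasurableSpace ι] [MeasurableSingletonClass ι]
    (ν : Measure α) {E : Set α} {d : α → ι} (hd : Measurable d) :
    ∑ c, ν {z | z ∈ E ∧ d z = c} = ν E := by
  have h := sum_measure_preimage_singleton (μ := ν.restrict E) (Finset.univ : Finset ι) (f := d)
    fun c _ => hd (measurableSet_singleton c)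
  simp only [Finset.coe_univ, Set.preimage_univ, Measure.restrict_apply_univ] at h
  rw [← h]
  refine Finset.sum_congr rfl fun c _ => ?_
  rw [Measure.restrict_apply (hd (measurableSet_singleton c)), Set.inter_comm]
  rfl

/-- A message that does not influence the output law is guessed correctly with total weight one. -/
lemma sum_pi_fiber_eq_one [Fintype ι] [MeasurableSpace ι] [MeasurableSingletonClass ι]
    (Q : Kernel τ α) [IsMarkovKernel Q] (x : ι → Fin N → τ) (c₀ : ι)
    (hx : ∀ c t, Q (x c t) = Q (x c₀ t)) {d : (Fin N → α) → ι} (hd : Measurable d) :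
    ∑ c, Measure.pi (fun t => Q (x c t)) {z | d z = c} = 1 := by
  have := sum_measure_inter_fiber (Measure.pi fun t => Q (x c₀ t)) (E := Set.univ) hd
  simp_rw [hx]
  simpa using this

/-- Both stages are blind to `c`, so the events run over a partition under one fixed law, and
summing removes the second decoder. Iterating this peels the users off, last output first. -/
lemma sum_pi_compProd_fiber [Fintype ι] [MeasurableSpace ι] [MeasurableSingletonClass ι]
    (Q₀ : Kernel τ α) (Q₁ : Kernel (τ × α) β) [IsMarkovKernel Q₀] [IsMarkovKernel Q₁]
    (x : ι → Fin N → τ) (c₀ : ι) (h₀ : ∀ c t, Q₀ (x c t) = Q₀ (x c₀ t))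
    (h₁ : ∀ c t a, Q₁ (x c t, a) = Q₁ (x c₀ t, a))
    {E : Set (Fin N → α)} (hE : MeasurableSet E) {d : (Fin N → β) → ι} (hd : Measurable d) :
    ∑ c, Measure.pi (fun t => (Q₀ ⊗ₖ Q₁) (x c t))
        {z | (fun t => (z t).1) ∈ E ∧ d (fun t => (z t).2) = c}
      = Measure.pi (fun t => Q₀ (x c₀ t)) E := by
  have hx : ∀ c t, (Q₀ ⊗ₖ Q₁) (x c t) = (Q₀ ⊗ₖ Q₁) (x c₀ t) := fun c t =>
    compProd_apply_congr (h₀ c t) (h₁ c t)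
  simp_rw [hx]
  have hd' : Measurable fun z : Fin N → α × β => d fun t => (z t).2 := by fun_prop
  refine (sum_measure_inter_fiber (E := {z | (fun t => (z t).1) ∈ E}) _ hd').trans ?_
  have hmap := Measure.pi_map_pi (μ := fun t => (Q₀ ⊗ₖ Q₁) (x c₀ t))
    (f := fun _ : Fin N => (Prod.fst : α × β → α)) fun _ => measurable_fst.aemeasurable
  simp only [compProd_map_fst_apply] at hmap
  rw [← hmap, Measure.map_apply (by fun_prop) hE]
  rfl

/-- The empirical law of the inputs `x s t`. -/
noncomputable def empirical [Fintype σ] (x : σ → Fin N → τ) : Measure τ :=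
  ((N : ℝ≥0∞) * Fintype.card σ)⁻¹ • ∑ s, ∑ t, Measure.dirac (x s t)

lemma isProbabilityMeasure_empirical [Fintype σ] [Nonempty σ] (hN : N ≠ 0) (x : σ → Fin N → τ) :
    IsProbabilityMeasure (empirical x) := ⟨by
  simp only [empirical, Measure.smul_apply, Measure.finsetSum_apply, measure_univ,
    Finset.sum_const, Finset.card_univ, Fintype.card_fin, nsmul_eq_mul, mul_one, smul_eq_mul]
  rw [mul_comm (N : ℝ≥0∞)]
  refine ENNReal.inv_mul_cancel ?_ ?_
  · simp [hN]
  · exact ENNReal.mul_ne_top (by simp) (by simp)⟩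

lemma sum_sum_klDiv_eq_condDiv_empirical [MeasurableSingletonClass τ] [Fintype σ] [Nonempty σ]
    (hN : N ≠ 0) (x : σ → Fin N → τ) (K Q : Kernel τ α) :
    ∑ s, ∑ t, klDiv (K (x s t)) (Q (x s t))
      = Fintype.card σ * (N * condDiv (empirical x) K Q) := by
  rw [condDiv, empirical, lintegral_smul_measure, lintegral_finsetSum_measure]
  simp_rw [lintegral_finsetSum_measure, lintegral_dirac]
  rw [smul_eq_mul, ← mul_assoc, ← mul_assoc, mul_comm (Fintype.card σ : ℝ≥0∞),
    ENNReal.mul_inv_cancel, one_mul]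
  · simp [hN]
  · exact ENNReal.mul_ne_top (by simp) (by simp)

/-- If correct decisions have probability at least `1 - ε` under the memoryless channel and at most
`1 / M` under the alternative, then `log M` is bounded by the divergence. -/
lemma ofReal_log_le_condDiv [MeasurableSingletonClass τ] [Fintype σ] [Nonempty σ] (hN : N ≠ 0)
    (W : Kernel τ β) [IsMarkovKernel W] {u : β → α} (hu : Measurable u)
    (Q : Kernel τ α) [IsMarkovKernel Q] (x : σ → Fin N → τ) {A : σ → Set (Fin N → α)}
    (hA : ∀ s, MeasurableSet (A s)) {M : ℕ} (hM : M ≠ 0) {ε : ℝ≥0∞}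
    (hQ : M * ∑ s, Measure.pi (fun t => Q (x s t)) (A s) ≤ Fintype.card σ)
    (hW : ∑ s, Measure.pi (fun t => W (x s t)) {y | (fun t => u (y t)) ∉ A s}
      ≤ Fintype.card σ * ε) :
    ENNReal.ofReal (Real.log M)
      ≤ N * condDiv (empirical x) (W.map u) Q + 1 + ENNReal.ofReal (Real.log M) * ε := by
  have hK : IsMarkovKernel (W.map u) := Kernel.IsMarkovKernel.map W hu
  set n : ℝ≥0∞ := (Fintype.card σ : ℝ≥0∞) with hn
  have hn0 : n ≠ 0 := by simp [hn]
  have hnt : n ≠ ∞ := by simp [hn]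
  set L := Real.log M with hL
  have hexp : ENNReal.ofReal (Real.exp L) = M := by
    rw [hL, Real.exp_log (by positivity)]; simp
  have hpi : ∀ s, Measure.pi (fun t => (W.map u) (x s t))
      = (Measure.pi fun t => W (x s t)).map fun y t => u (y t) := by
    intro s
    rw [Measure.pi_map_pi (μ := fun t => W (x s t)) (f := fun _ => u) fun _ => hu.aemeasurable]
    simp_rw [Kernel.map_apply W hu]
  have h1 : ∀ s, ENNReal.ofReal L
      ≤ (∑ t, klDiv ((W.map u) (x s t)) (Q (x s t)) + M * Measure.pi (fun t => Q (x s t)) (A s))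
        + ENNReal.ofReal L * Measure.pi (fun t => W (x s t)) {y | (fun t => u (y t)) ∉ A s} := by
    intro s
    -- With `L = log M` the weight `exp L` equals `M`, and `hQ` bounds the alternative's
    -- contribution by 1 on average over `s`.
    have h := ofReal_mul_measure_le_klDiv_add (Measure.pi fun t => (W.map u) (x s t))
      (Measure.pi fun t => Q (x s t)) (hA s) L
    rw [klDiv_pi, hexp] at h
    refine le_trans ?_ (add_le_add_left h _)
    have hc : Measure.pi (fun t => W (x s t)) {y | (fun t => u (y t)) ∉ A s}
        = Measure.pi (fun t => (W.map u) (x s t)) (A s)ᶜ := by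
      rw [hpi, Measure.map_apply (by fun_prop) (hA s).compl]
      rfl
    rw [hc, ← mul_add, prob_add_prob_compl (hA s), mul_one]
  have h2 : n * ENNReal.ofReal L
      ≤ n * (N * condDiv (empirical x) (W.map u) Q + 1 + ENNReal.ofReal L * ε) := by
    calc n * ENNReal.ofReal L = ∑ _s : σ, ENNReal.ofReal L := by simp [hn]
      _ ≤ _ := Finset.sum_le_sum fun s _ => h1 s
      _ = n * (N * condDiv (empirical x) (W.map u) Q)
          + M * ∑ s, Measure.pi (fun t => Q (x s t)) (A s)
          + ENNReal.ofReal L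
            * ∑ s, Measure.pi (fun t => W (x s t)) {y | (fun t => u (y t)) ∉ A s} := by
        rw [Finset.sum_add_distrib, Finset.sum_add_distrib,
          sum_sum_klDiv_eq_condDiv_empirical hN, ← Finset.mul_sum, ← Finset.mul_sum]
      _ ≤ n * (N * condDiv (empirical x) (W.map u) Q) + n + ENNReal.ofReal L * (n * ε) := by
        gcongr
      _ = _ := by ring
  exact (ENNReal.mul_le_mul_iff_right hn0 hnt).1 h2

end Testing

/-! ### The converse for one code. -/

section Converse

variable {X₁ X₂ X₃ Y₁ Y₂ Y₃ : Type*} [MeasurableSpace X₁] [MeasurableSpace X₂]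
  [MeasurableSpace X₃] [MeasurableSpace Y₁] [MeasurableSpace Y₂] [MeasurableSpace Y₃]

variable (X₁ X₂ X₃ Y₁ Y₂ Y₃) in
/-- Output laws of user 1 that depend only on the input of user 2. -/
def alternatives₁ : Set (Kernel (X₁ × X₂ × X₃) Y₁) := kernelsThrough (fun x => x.2.1) Y₁

variable (X₁ X₂ X₃ Y₁ Y₂ Y₃) in
/-- Output laws of user 2 that depend only on the input of user 1. -/
def alternatives₂ : Set (Kernel (X₁ × X₂ × X₃) Y₂) := kernelsThrough (fun x => x.1) Y₂

variable (X₁ X₂ X₃ Y₁ Y₂ Y₃) in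
/-- Output laws of users 1 and 3, drawn in this order, that do not use the input of user 3 and in
which the first output depends only on the input of user 2. -/
def alternatives₁₃ : Set (Kernel (X₁ × X₂ × X₃) (Y₁ × Y₃)) :=
  sequentialKernels (alternatives₁ X₁ X₂ X₃ Y₁) (fun p => (p.1.1, p.1.2.1, p.2)) Y₃

variable (X₁ X₂ X₃ Y₁ Y₂ Y₃) in
/-- Output laws of users 2 and 3, drawn in this order, that do not use the input of user 3 and in
which the first output depends only on the input of user 1. -/
def alternatives₂₃ : Set (Kernel (X₁ × X₂ × X₃) (Y₂ × Y₃)) :=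
  sequentialKernels (alternatives₂ X₁ X₂ X₃ Y₂) (fun p => (p.1.1, p.1.2.1, p.2)) Y₃

variable (X₁ X₂ X₃ Y₁ Y₂ Y₃) in
/-- Output laws drawn in the order 1, 2, 3, each depending only on the previous outputs and on the
inputs of their users. -/
def alternatives₁₂₃ : Set (Kernel (X₁ × X₂ × X₃) ((Y₁ × Y₂) × Y₃)) :=
  sequentialKernels
    (sequentialKernels (kernelsThrough (fun _ => ()) Y₁) (fun p => (p.1.1, p.2)) Y₂)
    (fun p => (p.1.2.1, p.2.2, p.1.1, p.2.1)) Y₃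

variable (X₁ X₂ X₃ Y₁ Y₂ Y₃) in
/-- Output laws drawn in the order 2, 1, 3, each depending only on the previous outputs and on the
inputs of their users. -/
def alternatives₂₁₃ : Set (Kernel (X₁ × X₂ × X₃) ((Y₂ × Y₁) × Y₃)) :=
  sequentialKernels
    (sequentialKernels (kernelsThrough (fun _ => ()) Y₂) (fun p => (p.1.2.1, p.2)) Y₁)
    (fun p => (p.1.2.1, p.2.1, p.1.1, p.2.2)) Y₃

/-- The value `c` (in nats) is a lower bound for the divergences of the channel from all
alternatives, averaged over the input law `P`. -/
structure IsDivergenceBound (W : Kernel (X₁ × X₂ × X₃) (Y₁ × Y₂ × Y₃))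
    (P : Measure (X₁ × X₂ × X₃)) (c : ℝ≥0∞) : Prop where
  le₁₃ : ∀ Q ∈ alternatives₁₃ X₁ X₂ X₃ Y₁ Y₃, ∀ Q' ∈ alternatives₂ X₁ X₂ X₃ Y₂,
    c ≤ condDiv P (W.map fun y => (y.1, y.2.2)) Q + condDiv P (W.map fun y => y.2.1) Q'
  le₂₃ : ∀ Q ∈ alternatives₂₃ X₁ X₂ X₃ Y₂ Y₃, ∀ Q' ∈ alternatives₁ X₁ X₂ X₃ Y₁,
    c ≤ condDiv P (W.map fun y => (y.2.1, y.2.2)) Q + condDiv P (W.map fun y => y.1) Q'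
  le₁₂₃ : ∀ Q ∈ alternatives₁₂₃ X₁ X₂ X₃ Y₁ Y₂ Y₃,
    c ≤ condDiv P (W.map fun y => ((y.1, y.2.1), y.2.2)) Q
  le₂₁₃ : ∀ Q ∈ alternatives₂₁₃ X₁ X₂ X₃ Y₁ Y₂ Y₃,
    c ≤ condDiv P (W.map fun y => ((y.2.1, y.1), y.2.2)) Q

namespace Code

variable {N M₁ M₂ M₃ : ℕ} (c : Code X₁ X₂ X₃ Y₁ Y₂ Y₃ N M₁ M₂ M₃)
  (W : Kernel (X₁ × X₂ × X₃) (Y₁ × Y₂ × Y₃))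

lemma sum_error₁ (h₁ : M₁ ≠ 0) (h₂ : M₂ ≠ 0) (h₃ : M₃ ≠ 0) :
    ∑ w, c.outputLaw W w {y | c.dec₁ (fun t => (y t).1) ≠ w.1}
      ≤ (Fintype.card (Fin M₁ × Fin M₂ × Fin M₃) : ℝ≥0∞) * c.errorProb W := by
  have : c.errorProb₁ W ≤ c.errorProb W := le_max_left _ _
  refine le_trans (le_of_eq ?_) (mul_le_mul_right this _)
  simp only [Fintype.card_prod, Fintype.card_fin, Nat.cast_mul, ← mul_assoc]
  rw [errorProb₁, ENNReal.mul_div_cancel] <;> simp [h₁, h₂, h₃, ENNReal.mul_eq_top]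

lemma sum_error₂ (h₁ : M₁ ≠ 0) (h₂ : M₂ ≠ 0) (h₃ : M₃ ≠ 0) :
    ∑ w, c.outputLaw W w {y | c.dec₂ (fun t => (y t).2.1) ≠ w.2.1}
      ≤ (Fintype.card (Fin M₁ × Fin M₂ × Fin M₃) : ℝ≥0∞) * c.errorProb W := by
  have : c.errorProb₂ W ≤ c.errorProb W := (le_max_left _ _).trans (le_max_right _ _)
  refine le_trans (le_of_eq ?_) (mul_le_mul_right this _)
  simp only [Fintype.card_prod, Fintype.card_fin, Nat.cast_mul, ← mul_assoc]
  rw [errorProb₂, ENNReal.mul_div_cancel] <;> simp [h₁, h₂, h₃, ENNReal.mul_eq_top]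

lemma sum_error₃ (h₁ : M₁ ≠ 0) (h₂ : M₂ ≠ 0) (h₃ : M₃ ≠ 0) :
    ∑ w, c.outputLaw W w {y | c.dec₃ (fun t => (y t).2.2) ≠ w.2.2}
      ≤ (Fintype.card (Fin M₁ × Fin M₂ × Fin M₃) : ℝ≥0∞) * c.errorProb W := by
  have : c.errorProb₃ W ≤ c.errorProb W := (le_max_right _ _).trans (le_max_right _ _)
  refine le_trans (le_of_eq ?_) (mul_le_mul_right this _)
  simp only [Fintype.card_prod, Fintype.card_fin, Nat.cast_mul, ← mul_assoc]
  rw [errorProb₃, ENNReal.mul_div_cancel] <;> simp [h₁, h₂, h₃, ENNReal.mul_eq_top]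

/-- Correctness of users 1 and 3 is tested jointly. The sum over `w₃` goes first, since the third
message enters only the third input; what remains sees only the second input and is blind to `w₁`.
The factor 2 is the union bound over two decoders. -/
lemma ofReal_log_le_alternatives₁₃ [MeasurableSingletonClass (X₁ × X₂ × X₃)] [IsMarkovKernel W]
    (hN : N ≠ 0) (h₁ : M₁ ≠ 0) (h₂ : M₂ ≠ 0) (h₃ : M₃ ≠ 0)
    {Q : Kernel (X₁ × X₂ × X₃) (Y₁ × Y₃)} (hQ : Q ∈ alternatives₁₃ X₁ X₂ X₃ Y₁ Y₃) :
    ENNReal.ofReal (Real.log (M₁ * M₃ : ℕ))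
      ≤ N * condDiv (empirical c.input) (W.map fun y => (y.1, y.2.2)) Q + 1
        + ENNReal.ofReal (Real.log (M₁ * M₃ : ℕ)) * (2 * c.errorProb W) := by
  have : NeZero M₁ := ⟨h₁⟩
  have : NeZero M₂ := ⟨h₂⟩
  have : NeZero M₃ := ⟨h₃⟩
  obtain ⟨Q₀, hQ₀, Q₁, hQ₁, rfl⟩ := hQ
  have := isMarkovKernel_of_mem_kernelsThrough hQ₀
  have := isMarkovKernel_of_mem_kernelsThrough hQ₁
  have hd₁ := c.measurable_dec₁
  have hd₃ := c.measurable_dec₃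
  refine ofReal_log_le_condDiv hN W (by fun_prop) (Q₀ ⊗ₖ Q₁) c.input
    (A := fun w => {z | (fun t => (z t).1) ∈ c.dec₁ ⁻¹' {w.1} ∧ c.dec₃ (fun t => (z t).2) = w.2.2})
    (fun w => ?_) (mul_ne_zero h₁ h₃) ?_ ?_
  · have e₁ : Measurable fun z : Fin N → Y₁ × Y₃ => c.dec₁ fun t => (z t).1 := by fun_prop
    have e₃ : Measurable fun z : Fin N → Y₁ × Y₃ => c.dec₃ fun t => (z t).2 := by fun_prop
    exact (e₁ (measurableSet_singleton w.1)).inter (e₃ (measurableSet_singleton w.2.2))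
  · have hsum : ∀ (w₁ : Fin M₁) (w₂ : Fin M₂), ∑ w₃ : Fin M₃,
        Measure.pi (fun t => (Q₀ ⊗ₖ Q₁) (c.input (w₁, w₂, w₃) t))
          {z | (fun t => (z t).1) ∈ c.dec₁ ⁻¹' {w₁} ∧ c.dec₃ (fun t => (z t).2) = w₃}
        = Measure.pi (fun t => Q₀ (c.input (w₁, w₂, 0) t)) {z | c.dec₁ z = w₁} := fun w₁ w₂ =>
      sum_pi_compProd_fiber Q₀ Q₁ (fun w₃ => c.input (w₁, w₂, w₃)) 0
        (fun _ _ => apply_eq_of_mem_kernelsThrough hQ₀ rfl)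
        (fun _ _ _ => apply_eq_of_mem_kernelsThrough hQ₁ rfl)
        (hd₁ (measurableSet_singleton w₁)) hd₃
    have hsum' : ∀ w₂ : Fin M₂, ∑ w₁ : Fin M₁,
        Measure.pi (fun t => Q₀ (c.input (w₁, w₂, 0) t)) {z | c.dec₁ z = w₁} = 1 := fun w₂ =>
      sum_pi_fiber_eq_one Q₀ (fun w₁ => c.input (w₁, w₂, 0)) 0
        (fun _ _ => apply_eq_of_mem_kernelsThrough hQ₀ rfl) hd₁
    simp_rw [Fintype.sum_prod_type, hsum]
    rw [Finset.sum_comm]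
    simp_rw [hsum']
    simp only [Finset.sum_const, Finset.card_univ, Fintype.card_fin, Fintype.card_prod,
      nsmul_eq_mul, mul_one, Nat.cast_mul]
    exact le_of_eq (by ring)
  · refine le_trans ?_ ((add_le_add (c.sum_error₁ W h₁ h₂ h₃) (c.sum_error₃ W h₁ h₂ h₃)).trans
      (le_of_eq (by ring)))
    rw [← Finset.sum_add_distrib]
    refine Finset.sum_le_sum fun w _ => le_trans (measure_mono fun y hy => ?_) (measure_union_le _ _)
    simp only [Set.mem_ofPred_eq, Set.mem_preimage, Set.mem_singleton_iff, not_and_or] at hy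
    exact hy

lemma ofReal_log_le_alternatives₂₃ [MeasurableSingletonClass (X₁ × X₂ × X₃)] [IsMarkovKernel W]
    (hN : N ≠ 0) (h₁ : M₁ ≠ 0) (h₂ : M₂ ≠ 0) (h₃ : M₃ ≠ 0)
    {Q : Kernel (X₁ × X₂ × X₃) (Y₂ × Y₃)} (hQ : Q ∈ alternatives₂₃ X₁ X₂ X₃ Y₂ Y₃) :
    ENNReal.ofReal (Real.log (M₂ * M₃ : ℕ))
      ≤ N * condDiv (empirical c.input) (W.map fun y => (y.2.1, y.2.2)) Q + 1
        + ENNReal.ofReal (Real.log (M₂ * M₃ : ℕ)) * (2 * c.errorProb W) := by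
  have : NeZero M₁ := ⟨h₁⟩
  have : NeZero M₂ := ⟨h₂⟩
  have : NeZero M₃ := ⟨h₃⟩
  obtain ⟨Q₀, hQ₀, Q₁, hQ₁, rfl⟩ := hQ
  have := isMarkovKernel_of_mem_kernelsThrough hQ₀
  have := isMarkovKernel_of_mem_kernelsThrough hQ₁
  have hd₂ := c.measurable_dec₂
  have hd₃ := c.measurable_dec₃
  refine ofReal_log_le_condDiv hN W (by fun_prop) (Q₀ ⊗ₖ Q₁) c.input
    (A := fun w => {z | (fun t => (z t).1) ∈ c.dec₂ ⁻¹' {w.2.1} ∧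
      c.dec₃ (fun t => (z t).2) = w.2.2})
    (fun w => ?_) (mul_ne_zero h₂ h₃) ?_ ?_
  · have e₂ : Measurable fun z : Fin N → Y₂ × Y₃ => c.dec₂ fun t => (z t).1 := by fun_prop
    have e₃ : Measurable fun z : Fin N → Y₂ × Y₃ => c.dec₃ fun t => (z t).2 := by fun_prop
    exact (e₂ (measurableSet_singleton w.2.1)).inter (e₃ (measurableSet_singleton w.2.2))
  · have hsum : ∀ (w₁ : Fin M₁) (w₂ : Fin M₂), ∑ w₃ : Fin M₃,
        Measure.pi (fun t => (Q₀ ⊗ₖ Q₁) (c.input (w₁, w₂, w₃) t))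
          {z | (fun t => (z t).1) ∈ c.dec₂ ⁻¹' {w₂} ∧ c.dec₃ (fun t => (z t).2) = w₃}
        = Measure.pi (fun t => Q₀ (c.input (w₁, w₂, 0) t)) {z | c.dec₂ z = w₂} := fun w₁ w₂ =>
      sum_pi_compProd_fiber Q₀ Q₁ (fun w₃ => c.input (w₁, w₂, w₃)) 0
        (fun _ _ => apply_eq_of_mem_kernelsThrough hQ₀ rfl)
        (fun _ _ _ => apply_eq_of_mem_kernelsThrough hQ₁ rfl)
        (hd₂ (measurableSet_singleton w₂)) hd₃
    have hsum' : ∀ w₁ : Fin M₁, ∑ w₂ : Fin M₂,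
        Measure.pi (fun t => Q₀ (c.input (w₁, w₂, 0) t)) {z | c.dec₂ z = w₂} = 1 := fun w₁ =>
      sum_pi_fiber_eq_one Q₀ (fun w₂ => c.input (w₁, w₂, 0)) 0
        (fun _ _ => apply_eq_of_mem_kernelsThrough hQ₀ rfl) hd₂
    simp_rw [Fintype.sum_prod_type, hsum, hsum']
    simp only [Finset.sum_const, Finset.card_univ, Fintype.card_fin, Fintype.card_prod,
      nsmul_eq_mul, mul_one, Nat.cast_mul]
    exact le_of_eq (by ring)
  · refine le_trans ?_ ((add_le_add (c.sum_error₂ W h₁ h₂ h₃) (c.sum_error₃ W h₁ h₂ h₃)).trans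
      (le_of_eq (by ring)))
    rw [← Finset.sum_add_distrib]
    refine Finset.sum_le_sum fun w _ => le_trans (measure_mono fun y hy => ?_) (measure_union_le _ _)
    simp only [Set.mem_ofPred_eq, Set.mem_preimage, Set.mem_singleton_iff, not_and_or] at hy
    exact hy

lemma ofReal_log_le_alternatives₁ [MeasurableSingletonClass (X₁ × X₂ × X₃)] [IsMarkovKernel W]
    (hN : N ≠ 0) (h₁ : M₁ ≠ 0) (h₂ : M₂ ≠ 0) (h₃ : M₃ ≠ 0)
    {Q : Kernel (X₁ × X₂ × X₃) Y₁} (hQ : Q ∈ alternatives₁ X₁ X₂ X₃ Y₁) :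
    ENNReal.ofReal (Real.log M₁)
      ≤ N * condDiv (empirical c.input) (W.map fun y => y.1) Q + 1
        + ENNReal.ofReal (Real.log M₁) * c.errorProb W := by
  have : NeZero M₁ := ⟨h₁⟩
  have : NeZero M₂ := ⟨h₂⟩
  have : NeZero M₃ := ⟨h₃⟩
  have := isMarkovKernel_of_mem_kernelsThrough hQ
  have hd₁ := c.measurable_dec₁
  refine ofReal_log_le_condDiv hN W (by fun_prop) Q c.input (A := fun w => c.dec₁ ⁻¹' {w.1})
    (fun w => hd₁ (measurableSet_singleton w.1)) h₁ ?_ (c.sum_error₁ W h₁ h₂ h₃)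
  have hsum : ∀ w : Fin M₂ × Fin M₃, ∑ w₁ : Fin M₁,
      Measure.pi (fun t => Q (c.input (w₁, w) t)) (c.dec₁ ⁻¹' {w₁}) = 1 := fun w =>
    sum_pi_fiber_eq_one Q (fun w₁ => c.input (w₁, w)) 0
      (fun _ _ => apply_eq_of_mem_kernelsThrough hQ rfl) hd₁
  rw [Fintype.sum_prod_type, Finset.sum_comm]
  simp_rw [hsum]
  simp

lemma ofReal_log_le_alternatives₂ [MeasurableSingletonClass (X₁ × X₂ × X₃)] [IsMarkovKernel W]
    (hN : N ≠ 0) (h₁ : M₁ ≠ 0) (h₂ : M₂ ≠ 0) (h₃ : M₃ ≠ 0)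
    {Q : Kernel (X₁ × X₂ × X₃) Y₂} (hQ : Q ∈ alternatives₂ X₁ X₂ X₃ Y₂) :
    ENNReal.ofReal (Real.log M₂)
      ≤ N * condDiv (empirical c.input) (W.map fun y => y.2.1) Q + 1
        + ENNReal.ofReal (Real.log M₂) * c.errorProb W := by
  have : NeZero M₁ := ⟨h₁⟩
  have : NeZero M₂ := ⟨h₂⟩
  have : NeZero M₃ := ⟨h₃⟩
  have := isMarkovKernel_of_mem_kernelsThrough hQ
  have hd₂ := c.measurable_dec₂
  refine ofReal_log_le_condDiv hN W (by fun_prop) Q c.input (A := fun w => c.dec₂ ⁻¹' {w.2.1})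
    (fun w => hd₂ (measurableSet_singleton w.2.1)) h₂ ?_ (c.sum_error₂ W h₁ h₂ h₃)
  have hsum : ∀ (w₁ : Fin M₁) (w₃ : Fin M₃), ∑ w₂ : Fin M₂,
      Measure.pi (fun t => Q (c.input (w₁, w₂, w₃) t)) (c.dec₂ ⁻¹' {w₂}) = 1 := fun w₁ w₃ =>
    sum_pi_fiber_eq_one Q (fun w₂ => c.input (w₁, w₂, w₃)) 0
      (fun _ _ => apply_eq_of_mem_kernelsThrough hQ rfl) hd₂
  simp_rw [Fintype.sum_prod_type]
  simp_rw [Finset.sum_comm (s := (Finset.univ : Finset (Fin M₂))), hsum]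
  simp only [Finset.sum_const, Finset.card_univ, Fintype.card_fin, Fintype.card_prod,
    nsmul_eq_mul, mul_one, Nat.cast_mul]
  exact le_of_eq (by ring)

/-- All three decoders are tested jointly. The messages are summed out in the order 3, 2, 1,
opposite to the order in which the outputs are drawn. -/
lemma ofReal_log_le_alternatives₁₂₃ [MeasurableSingletonClass (X₁ × X₂ × X₃)] [IsMarkovKernel W]
    (hN : N ≠ 0) (h₁ : M₁ ≠ 0) (h₂ : M₂ ≠ 0) (h₃ : M₃ ≠ 0)
    {Q : Kernel (X₁ × X₂ × X₃) ((Y₁ × Y₂) × Y₃)}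
    (hQ : Q ∈ alternatives₁₂₃ X₁ X₂ X₃ Y₁ Y₂ Y₃) :
    ENNReal.ofReal (Real.log (M₁ * M₂ * M₃ : ℕ))
      ≤ N * condDiv (empirical c.input) (W.map fun y => ((y.1, y.2.1), y.2.2)) Q + 1
        + ENNReal.ofReal (Real.log (M₁ * M₂ * M₃ : ℕ)) * (3 * c.errorProb W) := by
  have : NeZero M₁ := ⟨h₁⟩
  have : NeZero M₂ := ⟨h₂⟩
  have : NeZero M₃ := ⟨h₃⟩
  obtain ⟨Q', ⟨Q₀, hQ₀, Q₁, hQ₁, rfl⟩, Q₂, hQ₂, rfl⟩ := hQ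
  have := isMarkovKernel_of_mem_kernelsThrough hQ₀
  have := isMarkovKernel_of_mem_kernelsThrough hQ₁
  have := isMarkovKernel_of_mem_kernelsThrough hQ₂
  have hd₁ := c.measurable_dec₁
  have hd₂ := c.measurable_dec₂
  have hd₃ := c.measurable_dec₃
  have hE : ∀ (w₁ : Fin M₁) (w₂ : Fin M₂), MeasurableSet {z : Fin N → Y₁ × Y₂ |
      (fun t => (z t).1) ∈ c.dec₁ ⁻¹' {w₁} ∧ c.dec₂ (fun t => (z t).2) = w₂} := fun w₁ w₂ => by
    have e₁ : Measurable fun z : Fin N → Y₁ × Y₂ => c.dec₁ fun t => (z t).1 := by fun_prop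
    have e₂ : Measurable fun z : Fin N → Y₁ × Y₂ => c.dec₂ fun t => (z t).2 := by fun_prop
    exact (e₁ (measurableSet_singleton w₁)).inter (e₂ (measurableSet_singleton w₂))
  refine ofReal_log_le_condDiv hN W (by fun_prop) ((Q₀ ⊗ₖ Q₁) ⊗ₖ Q₂) c.input
    (A := fun w => {z | (fun t => (z t).1) ∈ {z : Fin N → Y₁ × Y₂ |
      (fun t => (z t).1) ∈ c.dec₁ ⁻¹' {w.1} ∧ c.dec₂ (fun t => (z t).2) = w.2.1} ∧
      c.dec₃ (fun t => (z t).2) = w.2.2})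
    (fun w => ?_) (mul_ne_zero (mul_ne_zero h₁ h₂) h₃) ?_ ?_
  · have e : Measurable fun z : Fin N → (Y₁ × Y₂) × Y₃ => fun t => (z t).1 := by fun_prop
    have e₃ : Measurable fun z : Fin N → (Y₁ × Y₂) × Y₃ => c.dec₃ fun t => (z t).2 := by fun_prop
    exact (e (hE w.1 w.2.1)).inter (e₃ (measurableSet_singleton w.2.2))
  · have hsum₃ := fun (w₁ : Fin M₁) (w₂ : Fin M₂) =>
      sum_pi_compProd_fiber (Q₀ ⊗ₖ Q₁) Q₂ (fun w₃ => c.input (w₁, w₂, w₃)) 0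
        (fun _ _ => compProd_apply_congr (apply_eq_of_mem_kernelsThrough hQ₀ rfl)
          fun _ => apply_eq_of_mem_kernelsThrough hQ₁ rfl)
        (fun _ _ _ => apply_eq_of_mem_kernelsThrough hQ₂ rfl) (hE w₁ w₂) hd₃
    have hsum₂ := fun (w₁ : Fin M₁) =>
      sum_pi_compProd_fiber Q₀ Q₁ (fun w₂ => c.input (w₁, w₂, 0)) 0
        (fun _ _ => apply_eq_of_mem_kernelsThrough hQ₀ rfl)
        (fun _ _ _ => apply_eq_of_mem_kernelsThrough hQ₁ rfl)
        (hd₁ (measurableSet_singleton w₁)) hd₂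
    have hsum₁ : ∑ w₁, Measure.pi (fun t => Q₀ (c.input (w₁, 0, 0) t)) (c.dec₁ ⁻¹' {w₁}) = 1 :=
      sum_pi_fiber_eq_one Q₀ (fun w₁ => c.input (w₁, 0, 0)) 0
        (fun _ _ => apply_eq_of_mem_kernelsThrough hQ₀ rfl) hd₁
    simp_rw [Fintype.sum_prod_type, hsum₃, hsum₂]
    rw [hsum₁]
    simp [mul_assoc]
  · refine le_trans ?_ ((add_le_add (add_le_add (c.sum_error₁ W h₁ h₂ h₃)
      (c.sum_error₂ W h₁ h₂ h₃)) (c.sum_error₃ W h₁ h₂ h₃)).trans (le_of_eq (by ring)))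
    rw [← Finset.sum_add_distrib, ← Finset.sum_add_distrib]
    refine Finset.sum_le_sum fun w _ => le_trans (measure_mono fun y hy => ?_)
      ((measure_union_le _ _).trans (add_le_add_left (measure_union_le _ _) _))
    simp only [Set.mem_ofPred_eq, Set.mem_preimage, Set.mem_singleton_iff, not_and_or] at hy
    exact hy

lemma ofReal_log_le_alternatives₂₁₃ [MeasurableSingletonClass (X₁ × X₂ × X₃)] [IsMarkovKernel W]
    (hN : N ≠ 0) (h₁ : M₁ ≠ 0) (h₂ : M₂ ≠ 0) (h₃ : M₃ ≠ 0)
    {Q : Kernel (X₁ × X₂ × X₃) ((Y₂ × Y₁) × Y₃)}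
    (hQ : Q ∈ alternatives₂₁₃ X₁ X₂ X₃ Y₁ Y₂ Y₃) :
    ENNReal.ofReal (Real.log (M₁ * M₂ * M₃ : ℕ))
      ≤ N * condDiv (empirical c.input) (W.map fun y => ((y.2.1, y.1), y.2.2)) Q + 1
        + ENNReal.ofReal (Real.log (M₁ * M₂ * M₃ : ℕ)) * (3 * c.errorProb W) := by
  have : NeZero M₁ := ⟨h₁⟩
  have : NeZero M₂ := ⟨h₂⟩
  have : NeZero M₃ := ⟨h₃⟩
  obtain ⟨Q', ⟨Q₀, hQ₀, Q₁, hQ₁, rfl⟩, Q₂, hQ₂, rfl⟩ := hQ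
  have := isMarkovKernel_of_mem_kernelsThrough hQ₀
  have := isMarkovKernel_of_mem_kernelsThrough hQ₁
  have := isMarkovKernel_of_mem_kernelsThrough hQ₂
  have hd₁ := c.measurable_dec₁
  have hd₂ := c.measurable_dec₂
  have hd₃ := c.measurable_dec₃
  have hE : ∀ (w₁ : Fin M₁) (w₂ : Fin M₂), MeasurableSet {z : Fin N → Y₂ × Y₁ |
      (fun t => (z t).1) ∈ c.dec₂ ⁻¹' {w₂} ∧ c.dec₁ (fun t => (z t).2) = w₁} := fun w₁ w₂ => by
    have e₁ : Measurable fun z : Fin N → Y₂ × Y₁ => c.dec₁ fun t => (z t).2 := by fun_prop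
    have e₂ : Measurable fun z : Fin N → Y₂ × Y₁ => c.dec₂ fun t => (z t).1 := by fun_prop
    exact (e₂ (measurableSet_singleton w₂)).inter (e₁ (measurableSet_singleton w₁))
  refine ofReal_log_le_condDiv hN W (by fun_prop) ((Q₀ ⊗ₖ Q₁) ⊗ₖ Q₂) c.input
    (A := fun w => {z | (fun t => (z t).1) ∈ {z : Fin N → Y₂ × Y₁ |
      (fun t => (z t).1) ∈ c.dec₂ ⁻¹' {w.2.1} ∧ c.dec₁ (fun t => (z t).2) = w.1} ∧
      c.dec₃ (fun t => (z t).2) = w.2.2})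
    (fun w => ?_) (mul_ne_zero (mul_ne_zero h₁ h₂) h₃) ?_ ?_
  · have e : Measurable fun z : Fin N → (Y₂ × Y₁) × Y₃ => fun t => (z t).1 := by fun_prop
    have e₃ : Measurable fun z : Fin N → (Y₂ × Y₁) × Y₃ => c.dec₃ fun t => (z t).2 := by fun_prop
    exact (e (hE w.1 w.2.1)).inter (e₃ (measurableSet_singleton w.2.2))
  · have hsum₃ := fun (w₁ : Fin M₁) (w₂ : Fin M₂) =>
      sum_pi_compProd_fiber (Q₀ ⊗ₖ Q₁) Q₂ (fun w₃ => c.input (w₁, w₂, w₃)) 0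
        (fun _ _ => compProd_apply_congr (apply_eq_of_mem_kernelsThrough hQ₀ rfl)
          fun _ => apply_eq_of_mem_kernelsThrough hQ₁ rfl)
        (fun _ _ _ => apply_eq_of_mem_kernelsThrough hQ₂ rfl) (hE w₁ w₂) hd₃
    have hsum₁ := fun (w₂ : Fin M₂) =>
      sum_pi_compProd_fiber Q₀ Q₁ (fun w₁ => c.input (w₁, w₂, 0)) 0
        (fun _ _ => apply_eq_of_mem_kernelsThrough hQ₀ rfl)
        (fun _ _ _ => apply_eq_of_mem_kernelsThrough hQ₁ rfl)
        (hd₂ (measurableSet_singleton w₂)) hd₁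
    have hsum₂ : ∑ w₂, Measure.pi (fun t => Q₀ (c.input (0, w₂, 0) t)) (c.dec₂ ⁻¹' {w₂}) = 1 :=
      sum_pi_fiber_eq_one Q₀ (fun w₂ => c.input (0, w₂, 0)) 0
        (fun _ _ => apply_eq_of_mem_kernelsThrough hQ₀ rfl) hd₂
    simp_rw [Fintype.sum_prod_type, hsum₃]
    rw [Finset.sum_comm]
    simp_rw [hsum₁]
    rw [hsum₂]
    simp [mul_assoc]
  · refine le_trans ?_ ((add_le_add (add_le_add (c.sum_error₂ W h₁ h₂ h₃)
      (c.sum_error₁ W h₁ h₂ h₃)) (c.sum_error₃ W h₁ h₂ h₃)).trans (le_of_eq (by ring)))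
    rw [← Finset.sum_add_distrib, ← Finset.sum_add_distrib]
    refine Finset.sum_le_sum fun w _ => le_trans (measure_mono fun y hy => ?_)
      ((measure_union_le _ _).trans (add_le_add_left (measure_union_le _ _) _))
    simp only [Set.mem_ofPred_eq, Set.mem_preimage, Set.mem_singleton_iff, not_and_or] at hy
    exact hy

/-- The converse for a single code. -/
lemma isDivergenceBound_empirical [MeasurableSingletonClass (X₁ × X₂ × X₃)] [IsMarkovKernel W]
    (hN : N ≠ 0) (h₁ : M₁ ≠ 0) (h₂ : M₂ ≠ 0) (h₃ : M₃ ≠ 0) {b : ℝ≥0∞}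
    (hb : ∀ D : ℝ≥0∞, ENNReal.ofReal (Real.log (M₁ * M₂ * M₃ : ℕ))
      ≤ N * D + 2 + ENNReal.ofReal (Real.log (M₁ * M₂ * M₃ : ℕ)) * (3 * c.errorProb W) → b ≤ D) :
    IsDivergenceBound W (empirical c.input) b := by
  have hlog : ∀ {a b m : ℕ}, a ≠ 0 → b ≠ 0 → m = a * b → ENNReal.ofReal (Real.log m)
      = ENNReal.ofReal (Real.log a) + ENNReal.ofReal (Real.log b) := by
    rintro a b _ ha hb rfl
    rw [Nat.cast_mul, Real.log_mul (by positivity) (by positivity),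
      ENNReal.ofReal_add (Real.log_natCast_nonneg _) (Real.log_natCast_nonneg _)]
  have hadd : ∀ {x y D D' e : ℝ≥0∞}, x ≤ N * D + 1 + x * (2 * e) → y ≤ N * D' + 1 + y * e →
      x + y ≤ N * (D + D') + 2 + (x + y) * (3 * e) := by
    intro x y D D' e hx hy
    calc x + y ≤ (N * D + 1 + x * (2 * e)) + (N * D' + 1 + y * e) := add_le_add hx hy
      -- The error factors 2 and 1 of the two separate tests are both raised to 3, the factor of the
      -- joint tests, so that one hypothesis `hb` covers all four cases.
      _ ≤ (N * D + 1 + x * (3 * e)) + (N * D' + 1 + y * (3 * e)) := by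
        gcongr
        · norm_num
        · exact le_mul_of_one_le_left zero_le (by norm_num)
      _ = _ := by ring
  have hone : ∀ {x y : ℝ≥0∞}, x + 1 + y ≤ x + 2 + y := fun {x y} => by
    gcongr
    norm_num
  refine ⟨fun Q hQ Q' hQ' => hb _ ?_, fun Q hQ Q' hQ' => hb _ ?_, fun Q hQ => hb _ ?_,
    fun Q hQ => hb _ ?_⟩
  · rw [hlog (mul_ne_zero h₁ h₃) h₂ (by ring)]
    exact hadd (c.ofReal_log_le_alternatives₁₃ W hN h₁ h₂ h₃ hQ)
      (c.ofReal_log_le_alternatives₂ W hN h₁ h₂ h₃ hQ')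
  · rw [hlog (mul_ne_zero h₂ h₃) h₁ (by ring)]
    exact hadd (c.ofReal_log_le_alternatives₂₃ W hN h₁ h₂ h₃ hQ)
      (c.ofReal_log_le_alternatives₁ W hN h₁ h₂ h₃ hQ')
  · exact (c.ofReal_log_le_alternatives₁₂₃ W hN h₁ h₂ h₃ hQ).trans hone
  · exact (c.ofReal_log_le_alternatives₂₁₃ W hN h₁ h₂ h₃ hQ).trans hone

end Code

end Converse

/-! ### Message counts and large block lengths. -/

section Asymptotics

lemma one_le_two_rpow {N : ℕ} {R : ℝ} (hR : 0 ≤ R) : (1 : ℝ) ≤ (2 : ℝ) ^ ((N : ℝ) * R) :=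
  Real.one_le_rpow (by norm_num) (by positivity)

lemma numMessages_ne_zero {N : ℕ} {R : ℝ} (hR : 0 ≤ R) : numMessages N R ≠ 0 :=
  (Nat.floor_pos.2 (one_le_two_rpow hR)).ne'

lemma log_numMessages_le {N : ℕ} {R : ℝ} (hR : 0 ≤ R) :
    Real.log (numMessages N R) ≤ N * R * Real.log 2 := by
  have h0 : (0 : ℝ) < numMessages N R := by
    exact_mod_cast Nat.pos_of_ne_zero (numMessages_ne_zero hR)
  rw [← Real.log_rpow (by norm_num)]
  exact Real.log_le_log h0 (Nat.floor_le (by positivity))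

/-- Rounding down a number that is at least 1 loses at most a factor 2. -/
lemma le_log_numMessages {N : ℕ} {R : ℝ} (hR : 0 ≤ R) :
    N * R * Real.log 2 - Real.log 2 ≤ Real.log (numMessages N R) := by
  have h1 := one_le_two_rpow (N := N) hR
  have h2 : (1 : ℝ) ≤ numMessages N R := by
    exact_mod_cast Nat.one_le_iff_ne_zero.2 (numMessages_ne_zero hR)
  have h3 : (2 : ℝ) ^ ((N : ℝ) * R) < numMessages N R + 1 := Nat.lt_floor_add_one _
  rw [← Real.log_rpow (by norm_num), ← Real.log_div (by positivity) (by norm_num)]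
  exact Real.log_le_log (by positivity) (by linarith)

/-- If the normalized log-size of the message set tends to `L` and the error probability vanishes,
then eventually every divergence satisfying the one-code bound exceeds any `b < L`. -/
lemma eventually_le_of_log_le {L k : ℝ} (hL : 0 ≤ L) {x : ℕ → ℝ} {ε : ℕ → ℝ≥0∞}
    (hx : ∀ N, N * L - k ≤ x N) (hx' : ∀ N, x N ≤ N * L) (hε : Tendsto ε atTop (𝓝 0))
    {b : ℝ≥0∞} (hb : b < ENNReal.ofReal L) :
    ∀ᶠ N : ℕ in atTop, ∀ D : ℝ≥0∞,
      ENNReal.ofReal (x N) ≤ N * D + 2 + ENNReal.ofReal (x N) * (3 * ε N) → b ≤ D := by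
  have hbt : b ≠ ∞ := (hb.trans ENNReal.ofReal_lt_top).ne
  have hbL : b.toReal < L := (ENNReal.lt_ofReal_iff_toReal_lt hbt).1 hb
  have hε' : Tendsto (fun N => (ε N).toReal) atTop (𝓝 0) :=
    (ENNReal.tendsto_toReal ENNReal.zero_ne_top).comp hε
  have hinv : Tendsto (fun N : ℕ => (k + 2) * ((N : ℝ))⁻¹) atTop (𝓝 0) := by
    simpa using tendsto_inv_atTop_nhds_zero_nat.const_mul (k + 2)
  -- This is the lower bound on `D` obtained by dividing by `N`. It does not involve `D`, so one `N`
  -- works for all alternatives simultaneously.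
  have hlim : Tendsto (fun N : ℕ => L - (k + 2) * ((N : ℝ))⁻¹ - L * (3 * (ε N).toReal)) atTop
      (𝓝 (L - 0 - L * (3 * 0))) :=
    (tendsto_const_nhds.sub hinv).sub ((hε'.const_mul 3).const_mul L)
  have hev := hlim.eventually (lt_mem_nhds (show b.toReal < L - 0 - L * (3 * 0) by simpa using hbL))
  filter_upwards [hev, eventually_gt_atTop 0, hε.eventually (gt_mem_nhds ENNReal.zero_lt_top)]
    with N hN hN0 hεN D hD
  by_contra! hDb
  have hDt : D ≠ ∞ := (hDb.trans_le le_top).ne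
  have hDb' : D.toReal < b.toReal := (ENNReal.toReal_lt_toReal hDt hbt).2 hDb
  have hN0' : (0 : ℝ) < N := by exact_mod_cast hN0
  have h1 : x N ≤ N * D.toReal + 2 + N * L * (3 * (ε N).toReal) := by
    have h2 : ENNReal.ofReal (x N)
        ≤ ENNReal.ofReal (N * D.toReal + 2 + N * L * (3 * (ε N).toReal)) := by
      have e1 : (N : ℝ≥0∞) = ENNReal.ofReal N := by simp
      have e2 : D = ENNReal.ofReal D.toReal := (ENNReal.ofReal_toReal hDt).symm
      have e3 : ε N = ENNReal.ofReal (ε N).toReal := (ENNReal.ofReal_toReal hεN.ne).symm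
      have e4 : (2 : ℝ≥0∞) = ENNReal.ofReal 2 := by simp
      have e5 : (3 : ℝ≥0∞) = ENNReal.ofReal 3 := by simp
      rw [ENNReal.ofReal_add (by positivity) (by positivity),
        ENNReal.ofReal_add (by positivity) (by positivity), ENNReal.ofReal_mul (by positivity),
        ENNReal.ofReal_mul (p := N * L) (by positivity), ENNReal.ofReal_mul (p := 3) (by positivity),
        ← e1, ← e2, ← e3, ← e4, ← e5]
      refine hD.trans ?_
      gcongr
      exact hx' N
    exact (ENNReal.ofReal_le_ofReal_iff (by positivity)).1 h2
  have h3 := hx N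
  have h4 : N * b.toReal < N * (L - (k + 2) * ((N : ℝ))⁻¹ - L * (3 * (ε N).toReal)) :=
    mul_lt_mul_of_pos_left hN hN0'
  have h5 : N * (L - (k + 2) * ((N : ℝ))⁻¹ - L * (3 * (ε N).toReal))
      = N * L - (k + 2) - N * L * (3 * (ε N).toReal) := by
    field_simp
  have h6 := mul_lt_mul_of_pos_left hDb' hN0'
  linarith

end Asymptotics

/-! ### Passing to the limit in the input law. -/

section Limit

variable {τ α β : Type*} [MeasurableSpace τ] [MeasurableSpace α] [MeasurableSpace β]

/-- A bound by integrals of a finite function passes to limits of laws on a finite type. -/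
lemma le_lintegral_of_tendsto [Fintype τ] [MeasurableSingletonClass τ] {P : ℕ → Measure τ}
    {P' : Measure τ} (hP : ∀ x, Tendsto (fun n => P n {x}) atTop (𝓝 (P' {x}))) {b : ℕ → ℝ≥0∞}
    {b' : ℝ≥0∞} (hb : Tendsto b atTop (𝓝 b')) {d : τ → ℝ≥0∞} (hd : ∀ x, d x ≠ ∞)
    (h : ∀ n, b n ≤ ∫⁻ x, d x ∂P n) : b' ≤ ∫⁻ x, d x ∂P' := by
  refine le_of_tendsto_of_tendsto' hb ?_ h
  simp_rw [lintegral_fintype]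
  exact tendsto_finsetSum _ fun x _ => ENNReal.Tendsto.const_mul (hP x) (.inr (hd x))

/-- Infinite divergences at points whose mass tends to 0 would break continuity. The bound is
therefore passed to the limit for perturbed kernels `R`, `R'` with finite divergences, and the cost
`η` of the perturbation is then sent to 0. -/
lemma le_condDiv_add_of_tendsto [Finite τ] [Nonempty τ] [MeasurableSingletonClass τ]
    {P : ℕ → Measure τ} {P' : Measure τ} [IsProbabilityMeasure P']
    (hP : ∀ x, Tendsto (fun n => P n {x}) atTop (𝓝 (P' {x})))
    {b : ℕ → ℝ≥0∞} {b' : ℝ≥0∞} (hb : Tendsto b atTop (𝓝 b')) (K : Kernel τ α) (K' : Kernel τ β)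
    [IsMarkovKernel K] [IsMarkovKernel K'] {S : Set (Kernel τ α)} {S' : Set (Kernel τ β)}
    (hS : Dominable S) (hS' : Dominable S') (hm : ∀ Q ∈ S, IsMarkovKernel Q)
    (hm' : ∀ Q ∈ S', IsMarkovKernel Q)
    (h : ∀ n, ∀ Q ∈ S, ∀ Q' ∈ S', b n ≤ condDiv (P n) K Q + condDiv (P n) K' Q')
    {Q : Kernel τ α} (hQ : Q ∈ S) {Q' : Kernel τ β} (hQ' : Q' ∈ S') :
    b' ≤ condDiv P' K Q + condDiv P' K' Q' := by
  cases nonempty_fintype τ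
  refine ENNReal.le_of_forall_pos_le_add fun η hη _ => ?_
  have hη2 : (0 : ℝ) < η / 2 := by positivity
  obtain ⟨R, hR, H⟩ := hS.exists_klDiv_ne_top hm K hQ hη2
  obtain ⟨R', hR', H'⟩ := hS'.exists_klDiv_ne_top hm' K' hQ' hη2
  have hmeas : ∀ d : τ → ℝ≥0∞, Measurable d := fun d => measurable_of_finite d
  have key : b' ≤ ∫⁻ x, (klDiv (K x) (R x) + klDiv (K' x) (R' x)) ∂P' := by
    refine le_lintegral_of_tendsto hP hb (fun x => ENNReal.add_ne_top.2 ⟨(H x).1, (H' x).1⟩)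
      fun n => ?_
    rw [lintegral_add_left (hmeas _)]
    exact h n R hR R' hR'
  calc b' ≤ _ := key
    _ ≤ ∫⁻ x, (klDiv (K x) (Q x) + klDiv (K' x) (Q' x) + η) ∂P' := by
      refine lintegral_mono fun x => (add_le_add (H x).2 (H' x).2).trans (le_of_eq ?_)
      rw [add_add_add_comm, ← ENNReal.ofReal_add hη2.le hη2.le, add_halves,
        ENNReal.ofReal_coe_nnreal]
    _ = _ := by
      rw [lintegral_add_right _ measurable_const, lintegral_add_left (hmeas _)]
      simp [condDiv]

lemma le_condDiv_of_tendsto [Finite τ] [Nonempty τ] [MeasurableSingletonClass τ]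
    {P : ℕ → Measure τ} {P' : Measure τ} [IsProbabilityMeasure P']
    (hP : ∀ x, Tendsto (fun n => P n {x}) atTop (𝓝 (P' {x})))
    {b : ℕ → ℝ≥0∞} {b' : ℝ≥0∞} (hb : Tendsto b atTop (𝓝 b')) (K : Kernel τ α)
    [IsMarkovKernel K] {S : Set (Kernel τ α)}
    (hS : Dominable S) (hm : ∀ Q ∈ S, IsMarkovKernel Q)
    (h : ∀ n, ∀ Q ∈ S, b n ≤ condDiv (P n) K Q) {Q : Kernel τ α} (hQ : Q ∈ S) :
    b' ≤ condDiv P' K Q := by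
  cases nonempty_fintype τ
  refine ENNReal.le_of_forall_pos_le_add fun η hη _ => ?_
  obtain ⟨R, hR, H⟩ := hS.exists_klDiv_ne_top hm K hQ (NNReal.coe_pos.2 hη)
  calc b' ≤ condDiv P' K R := le_lintegral_of_tendsto hP hb (fun x => (H x).1) fun n => h n R hR
    _ ≤ ∫⁻ x, (klDiv (K x) (Q x) + η) ∂P' := lintegral_mono fun x => by
      simpa using (H x).2
    _ = _ := by
      rw [lintegral_add_right _ measurable_const]
      simp [condDiv]

/-- Sequential compactness of the laws on a finite type. -/
lemma exists_subseq_tendsto_singleton [Finite τ] [MeasurableSingletonClass τ]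
    (P : ℕ → ProbabilityMeasure τ) :
    ∃ (P' : ProbabilityMeasure τ) (φ : ℕ → ℕ), StrictMono φ ∧
      ∀ x, Tendsto (fun n => (P (φ n) : Measure τ) {x}) atTop (𝓝 ((P' : Measure τ) {x})) := by
  cases nonempty_fintype τ
  have hmem : ∀ n, (fun x => (P n : Measure τ).real {x}) ∈ stdSimplex ℝ τ := fun n => by
    refine ⟨fun x => measureReal_nonneg, ?_⟩
    have := sum_measureReal_singleton (μ := (P n : Measure τ)) (Finset.univ : Finset τ)
    simpa using this
  obtain ⟨p, hp, φ, hφ, hlim⟩ := (isCompact_stdSimplex ℝ τ).tendsto_subseq hmem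
  let ν : Measure τ := ∑ x, ENNReal.ofReal (p x) • Measure.dirac x
  have hν : ∀ x, ν {x} = ENNReal.ofReal (p x) := fun x => by
    simp only [ν, Measure.finsetSum_apply, Measure.smul_apply, smul_eq_mul,
      Measure.dirac_apply' _ (measurableSet_singleton x)]
    rw [Finset.sum_eq_single x]
    · simp
    · intro y _ hy
      simp [hy]
    · simp
  have hν1 : IsProbabilityMeasure ν := ⟨by
    simp only [ν, Measure.finsetSum_apply, Measure.smul_apply, smul_eq_mul, measure_univ, mul_one]
    rw [← ENNReal.ofReal_sum_of_nonneg fun x _ => hp.1 x, hp.2, ENNReal.ofReal_one]⟩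
  refine ⟨⟨ν, hν1⟩, φ, hφ, fun x => ?_⟩
  change Tendsto _ _ (𝓝 (ν {x}))
  rw [hν]
  have := ENNReal.tendsto_ofReal (tendsto_pi_nhds.1 hlim x)
  simpa using this

end Limit

/-! ### From divergence bounds to the mutual-information bounds. -/

section Main

variable {X₁ X₂ X₃ Y₁ Y₂ Y₃ : Type*} [MeasurableSpace X₁] [MeasurableSpace X₂]
  [MeasurableSpace X₃] [MeasurableSpace Y₁] [MeasurableSpace Y₂] [MeasurableSpace Y₃]

lemma exists_isDivergenceBound [MeasurableSingletonClass (X₁ × X₂ × X₃)]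
    (W : Kernel (X₁ × X₂ × X₃) (Y₁ × Y₂ × Y₃)) [IsMarkovKernel W] {b : ℝ≥0∞}
    (hb : b < sumCapacity W) :
    ∃ P : ProbabilityMeasure (X₁ × X₂ × X₃),
      IsDivergenceBound W P (b * ENNReal.ofReal (Real.log 2)) := by
  simp only [sumCapacity, lt_iSup_iff] at hb
  obtain ⟨R, ⟨h₁, h₂, h₃, c, hc⟩, hbR⟩ := hb
  have hlog2 : 0 < Real.log 2 := Real.log_pos (by norm_num)
  have hL : b * ENNReal.ofReal (Real.log 2)
      < ENNReal.ofReal ((R.1 + R.2.1 + R.2.2) * Real.log 2) := by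
    rw [ENNReal.ofReal_mul (by positivity)]
    exact ENNReal.mul_lt_mul_left log_two_ne_zero ENNReal.ofReal_ne_top hbR
  have hlog : ∀ N : ℕ, Real.log
      (numMessages N R.1 * numMessages N R.2.1 * numMessages N R.2.2 : ℕ)
      = Real.log (numMessages N R.1) + Real.log (numMessages N R.2.1)
        + Real.log (numMessages N R.2.2) := fun N => by
    have e₁ := numMessages_ne_zero (N := N) h₁
    have e₂ := numMessages_ne_zero (N := N) h₂
    have e₃ := numMessages_ne_zero (N := N) h₃
    rw [Nat.cast_mul, Nat.cast_mul, Real.log_mul (by positivity) (by positivity),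
      Real.log_mul (by positivity) (by positivity)]
  -- One `log 2` is lost to rounding for each of the three message sets.
  have hev := eventually_le_of_log_le (k := 3 * Real.log 2) (by positivity) (x := fun N => Real.log
      (numMessages N R.1 * numMessages N R.2.1 * numMessages N R.2.2 : ℕ))
    (fun N => by
      rw [hlog]
      have := le_log_numMessages (N := N) h₁
      have := le_log_numMessages (N := N) h₂
      have := le_log_numMessages (N := N) h₃
      linarith)
    (fun N => by
      rw [hlog]
      have := log_numMessages_le (N := N) h₁
      have := log_numMessages_le (N := N) h₂
      have := log_numMessages_le (N := N) h₃
      linarith) hc hL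
  obtain ⟨N, hN, hN0⟩ := (hev.and (eventually_ne_atTop 0)).exists
  have e₁ := numMessages_ne_zero (N := N) h₁
  have e₂ := numMessages_ne_zero (N := N) h₂
  have e₃ := numMessages_ne_zero (N := N) h₃
  have : NeZero (numMessages N R.1) := ⟨e₁⟩
  have : NeZero (numMessages N R.2.1) := ⟨e₂⟩
  have : NeZero (numMessages N R.2.2) := ⟨e₃⟩
  exact ⟨⟨empirical (c N).input, isProbabilityMeasure_empirical hN0 _⟩,
    (c N).isDivergenceBound_empirical W hN0 e₁ e₂ e₃ hN⟩

lemma isMarkovKernel_of_mem_alternatives₁₃ {Q : Kernel (X₁ × X₂ × X₃) (Y₁ × Y₃)}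
    (hQ : Q ∈ alternatives₁₃ X₁ X₂ X₃ Y₁ Y₃) : IsMarkovKernel Q :=
  isMarkovKernel_of_mem_sequentialKernels (fun _ => isMarkovKernel_of_mem_kernelsThrough) hQ

lemma isMarkovKernel_of_mem_alternatives₂₃ {Q : Kernel (X₁ × X₂ × X₃) (Y₂ × Y₃)}
    (hQ : Q ∈ alternatives₂₃ X₁ X₂ X₃ Y₂ Y₃) : IsMarkovKernel Q :=
  isMarkovKernel_of_mem_sequentialKernels (fun _ => isMarkovKernel_of_mem_kernelsThrough) hQ

lemma isMarkovKernel_of_mem_alternatives₁₂₃ {Q : Kernel (X₁ × X₂ × X₃) ((Y₁ × Y₂) × Y₃)}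
    (hQ : Q ∈ alternatives₁₂₃ X₁ X₂ X₃ Y₁ Y₂ Y₃) : IsMarkovKernel Q :=
  isMarkovKernel_of_mem_sequentialKernels (fun _ => isMarkovKernel_of_mem_sequentialKernels
    fun _ => isMarkovKernel_of_mem_kernelsThrough) hQ

lemma isMarkovKernel_of_mem_alternatives₂₁₃ {Q : Kernel (X₁ × X₂ × X₃) ((Y₂ × Y₁) × Y₃)}
    (hQ : Q ∈ alternatives₂₁₃ X₁ X₂ X₃ Y₁ Y₂ Y₃) : IsMarkovKernel Q :=
  isMarkovKernel_of_mem_sequentialKernels (fun _ => isMarkovKernel_of_mem_sequentialKernels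
    fun _ => isMarkovKernel_of_mem_kernelsThrough) hQ

/-- Moves from divergences of joint laws to averages over the input law, which is the first marginal
of `jointLaw W P`. -/
lemma exists_condDiv_le {α : Type*} [MeasurableSpace α] [StandardBorelSpace α]
    (W : Kernel (X₁ × X₂ × X₃) (Y₁ × Y₂ × Y₃)) [IsMarkovKernel W]
    (P : ProbabilityMeasure (X₁ × X₂ × X₃)) {u : Y₁ × Y₂ × Y₃ → α} (hu : Measurable u)
    {S : Set (Kernel (X₁ × X₂ × X₃) α)} (hS : ∀ Q ∈ S, IsMarkovKernel Q) {a : ℝ≥0∞}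
    (h : ∃ Q ∈ S, klDiv ((jointLaw W P).map fun ω => (ω.1, u ω.2))
      ((jointLaw W P).map (fun ω => ω.1) ⊗ₘ Q) ≤ a) :
    ∃ Q ∈ S, condDiv (P : Measure (X₁ × X₂ × X₃)) (W.map u) Q ≤ a := by
  obtain ⟨Q, hQ, h⟩ := h
  have := hS Q hQ
  have := Kernel.IsMarkovKernel.map W hu
  refine ⟨Q, hQ, (condDiv_le_klDiv_compProd _ _ _).trans (le_trans (le_of_eq ?_) h)⟩
  congr 1
  · rw [Measure.compProd_map hu]
    rfl
  · congr 1
    exact (Measure.fst_compProd _ _).symm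

variable [StandardBorelSpace Y₁] [StandardBorelSpace Y₂] [StandardBorelSpace Y₃]
  [Nonempty Y₁] [Nonempty Y₂] [Nonempty Y₃]

lemma IsDivergenceBound.of_tendsto [Finite (X₁ × X₂ × X₃)] [Nonempty (X₁ × X₂ × X₃)]
    [MeasurableSingletonClass (X₁ × X₂ × X₃)]
    (W : Kernel (X₁ × X₂ × X₃) (Y₁ × Y₂ × Y₃)) [IsMarkovKernel W]
    {P : ℕ → Measure (X₁ × X₂ × X₃)} {P' : Measure (X₁ × X₂ × X₃)} [IsProbabilityMeasure P']
    (hP : ∀ x, Tendsto (fun n => P n {x}) atTop (𝓝 (P' {x})))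
    {b : ℕ → ℝ≥0∞} {b' : ℝ≥0∞} (hb : Tendsto b atTop (𝓝 b'))
    (h : ∀ n, IsDivergenceBound W (P n) (b n)) : IsDivergenceBound W P' b' := by
  have hd₁ : Dominable (alternatives₁ X₁ X₂ X₃ Y₁) := dominable_kernelsThrough (by fun_prop)
  have hd₂ : Dominable (alternatives₂ X₁ X₂ X₃ Y₂) := dominable_kernelsThrough (by fun_prop)
  refine ⟨fun Q hQ Q' hQ' => ?_, fun Q hQ Q' hQ' => ?_, fun Q hQ => ?_, fun Q hQ => ?_⟩
  · have := Kernel.IsMarkovKernel.map W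
      (show Measurable fun y : Y₁ × Y₂ × Y₃ => (y.1, y.2.2) by fun_prop)
    have := Kernel.IsMarkovKernel.map W
      (show Measurable fun y : Y₁ × Y₂ × Y₃ => y.2.1 by fun_prop)
    exact le_condDiv_add_of_tendsto hP hb _ _
      (dominable_sequentialKernels hd₁ (fun _ => isMarkovKernel_of_mem_kernelsThrough)
        (by fun_prop) (r := fun q => q.2.2) (by fun_prop) fun _ => rfl)
      hd₂ (fun _ => isMarkovKernel_of_mem_alternatives₁₃)
      (fun _ => isMarkovKernel_of_mem_kernelsThrough) (fun n => (h n).le₁₃) hQ hQ'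
  · have := Kernel.IsMarkovKernel.map W
      (show Measurable fun y : Y₁ × Y₂ × Y₃ => (y.2.1, y.2.2) by fun_prop)
    have := Kernel.IsMarkovKernel.map W
      (show Measurable fun y : Y₁ × Y₂ × Y₃ => y.1 by fun_prop)
    exact le_condDiv_add_of_tendsto hP hb _ _
      (dominable_sequentialKernels hd₂ (fun _ => isMarkovKernel_of_mem_kernelsThrough)
        (by fun_prop) (r := fun q => q.2.2) (by fun_prop) fun _ => rfl)
      hd₁ (fun _ => isMarkovKernel_of_mem_alternatives₂₃)
      (fun _ => isMarkovKernel_of_mem_kernelsThrough) (fun n => (h n).le₂₃) hQ hQ'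
  · have := Kernel.IsMarkovKernel.map W
      (show Measurable fun y : Y₁ × Y₂ × Y₃ => ((y.1, y.2.1), y.2.2) by fun_prop)
    refine le_condDiv_of_tendsto hP hb _ ?_
      (fun _ => isMarkovKernel_of_mem_alternatives₁₂₃) (fun n => (h n).le₁₂₃) hQ
    -- The outer `r` extracts the pair of earlier outputs, in the order drawn, from the conditioning
    -- tuple `(x₂, y₂, x₁, y₁)`.
    exact dominable_sequentialKernels (dominable_sequentialKernels
      (dominable_kernelsThrough (by fun_prop)) (fun _ => isMarkovKernel_of_mem_kernelsThrough)
        (by fun_prop) (r := fun q => q.2) (by fun_prop) fun _ => rfl)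
      (fun _ => isMarkovKernel_of_mem_sequentialKernels
        fun _ => isMarkovKernel_of_mem_kernelsThrough)
      (by fun_prop) (r := fun q => (q.2.2.2, q.2.1)) (by fun_prop) fun _ => rfl
  · have := Kernel.IsMarkovKernel.map W
      (show Measurable fun y : Y₁ × Y₂ × Y₃ => ((y.2.1, y.1), y.2.2) by fun_prop)
    refine le_condDiv_of_tendsto hP hb _ ?_
      (fun _ => isMarkovKernel_of_mem_alternatives₂₁₃) (fun n => (h n).le₂₁₃) hQ
    exact dominable_sequentialKernels (dominable_sequentialKernels
      (dominable_kernelsThrough (by fun_prop)) (fun _ => isMarkovKernel_of_mem_kernelsThrough)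
        (by fun_prop) (r := fun q => q.2) (by fun_prop) fun _ => rfl)
      (fun _ => isMarkovKernel_of_mem_sequentialKernels
        fun _ => isMarkovKernel_of_mem_kernelsThrough)
      (by fun_prop) (r := fun q => (q.2.1, q.2.2.2)) (by fun_prop) fun _ => rfl

variable [StandardBorelSpace X₁] [StandardBorelSpace X₂] [StandardBorelSpace X₃]
  [Nonempty X₁] [Nonempty X₂] [Nonempty X₃]

/-- The alternatives are the conditional laws under `P`. The two branches of the minimum come from
`le₁₃` and `le₂₃`; both contain the same two unconditioned-on-output terms, used once inside the
pair and once alone. -/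
lemma IsDivergenceBound.le_boundA {W : Kernel (X₁ × X₂ × X₃) (Y₁ × Y₂ × Y₃)} [IsMarkovKernel W]
    {P : ProbabilityMeasure (X₁ × X₂ × X₃)} {b : ℝ≥0∞}
    (h : IsDivergenceBound W P (b * ENNReal.ofReal (Real.log 2))) : b ≤ boundA W P := by
  have e₁ := exists_kernelsThrough_klDiv_le_condMutualInfo (jointLaw W P)
    (T := fun ω => ω.1) (U := fun ω => ω.2.1) (V := fun ω => (ω.1.1, ω.1.2.2))
    (Z := fun ω => ω.1.2.1) (by fun_prop) (by fun_prop) (by fun_prop)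
    (f := fun x => x.2.1) (by fun_prop) (r := fun p => (p.2.1, p.1, p.2.2)) (by fun_prop)
    (fun _ => rfl) (fun _ => rfl)
  have e₂ := exists_kernelsThrough_klDiv_le_condMutualInfo (jointLaw W P)
    (T := fun ω => ω.1) (U := fun ω => ω.2.2.1) (V := fun ω => (ω.1.2.1, ω.1.2.2))
    (Z := fun ω => ω.1.1) (by fun_prop) (by fun_prop) (by fun_prop)
    (f := fun x => x.1) (by fun_prop) (r := fun p => (p.1, p.2.1, p.2.2)) (by fun_prop)
    (fun _ => rfl) (fun _ => rfl)
  have e₁₃ := exists_kernelsThrough_klDiv_le_condMutualInfo (jointLaw W P)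
    (T := fun ω => (ω.1, ω.2.1)) (U := fun ω => ω.2.2.2) (V := fun ω => ω.1.2.2)
    (Z := fun ω => (ω.1.1, ω.1.2.1, ω.2.1)) (by fun_prop) (by fun_prop) (by fun_prop)
    (f := fun p => (p.1.1, p.1.2.1, p.2)) (by fun_prop)
    (r := fun p => ((p.1.1, p.1.2.1, p.2), p.1.2.2)) (by fun_prop)
    (fun _ => rfl) (fun _ => rfl)
  have e₂₃ := exists_kernelsThrough_klDiv_le_condMutualInfo (jointLaw W P)
    (T := fun ω => (ω.1, ω.2.2.1)) (U := fun ω => ω.2.2.2) (V := fun ω => ω.1.2.2)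
    (Z := fun ω => (ω.1.1, ω.1.2.1, ω.2.2.1)) (by fun_prop) (by fun_prop) (by fun_prop)
    (f := fun p => (p.1.1, p.1.2.1, p.2)) (by fun_prop)
    (r := fun p => ((p.1.1, p.1.2.1, p.2), p.1.2.2)) (by fun_prop)
    (fun _ => rfl) (fun _ => rfl)
  obtain ⟨Q₁, hQ₁, h₁⟩ := exists_condDiv_le W P (u := fun y => y.1) (by fun_prop)
    (fun _ => isMarkovKernel_of_mem_kernelsThrough) e₁
  obtain ⟨Q₂, hQ₂, h₂⟩ := exists_condDiv_le W P (u := fun y => y.2.1) (by fun_prop)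
    (fun _ => isMarkovKernel_of_mem_kernelsThrough) e₂
  obtain ⟨Q₁₃, hQ₁₃, h₁₃⟩ := exists_condDiv_le W P (u := fun y => (y.1, y.2.2)) (by fun_prop)
    (fun _ => isMarkovKernel_of_mem_alternatives₁₃)
    (klDiv_compProd_sequential_le _ (by fun_prop) (by fun_prop) (by fun_prop)
      (fun _ => isMarkovKernel_of_mem_kernelsThrough) e₁ e₁₃)
  obtain ⟨Q₂₃, hQ₂₃, h₂₃⟩ := exists_condDiv_le W P (u := fun y => (y.2.1, y.2.2)) (by fun_prop)
    (fun _ => isMarkovKernel_of_mem_alternatives₂₃)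
    (klDiv_compProd_sequential_le _ (by fun_prop) (by fun_prop) (by fun_prop)
      (fun _ => isMarkovKernel_of_mem_kernelsThrough) e₂ e₂₃)
  rw [boundA, ← min_add_add_right, ← min_add_add_right]
  refine le_min ?_ ?_ <;>
    refine (ENNReal.mul_le_mul_iff_left log_two_ne_zero ENNReal.ofReal_ne_top).1 ?_ <;>
    simp only [add_mul]
  · refine (h.le₁₃ _ hQ₁₃ _ hQ₂).trans ((add_le_add h₁₃ h₂).trans (le_of_eq ?_))
    ring
  · refine (h.le₂₃ _ hQ₂₃ _ hQ₁).trans ((add_le_add h₂₃ h₁).trans (le_of_eq ?_))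
    ring

/-- The two branches of the minimum are the chain rule for the orders 1, 2, 3 and 2, 1, 3, which
share the term of user 3. -/
lemma IsDivergenceBound.le_boundB {W : Kernel (X₁ × X₂ × X₃) (Y₁ × Y₂ × Y₃)} [IsMarkovKernel W]
    {P : ProbabilityMeasure (X₁ × X₂ × X₃)} {b : ℝ≥0∞}
    (h : IsDivergenceBound W P (b * ENNReal.ofReal (Real.log 2))) : b ≤ boundB W P := by
  have e₁ := exists_kernelsThrough_klDiv_le_mutualInfo (jointLaw W P)
    (T := fun ω => ω.1) (U := fun ω => ω.2.1) (V := fun ω => (ω.1.1, ω.1.2.1, ω.1.2.2))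
    (by fun_prop) (by fun_prop) measurable_id (fun _ => rfl)
  have e₂ := exists_kernelsThrough_klDiv_le_mutualInfo (jointLaw W P)
    (T := fun ω => ω.1) (U := fun ω => ω.2.2.1) (V := fun ω => (ω.1.1, ω.1.2.1, ω.1.2.2))
    (by fun_prop) (by fun_prop) measurable_id (fun _ => rfl)
  have e₁₂ := exists_kernelsThrough_klDiv_le_condMutualInfo (jointLaw W P)
    (T := fun ω => (ω.1, ω.2.1)) (U := fun ω => ω.2.2.1) (V := fun ω => (ω.1.2.1, ω.1.2.2))
    (Z := fun ω => (ω.1.1, ω.2.1)) (by fun_prop) (by fun_prop) (by fun_prop)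
    (f := fun p => (p.1.1, p.2)) (by fun_prop)
    (r := fun p => ((p.1.1, p.2.1, p.2.2), p.1.2)) (by fun_prop)
    (fun _ => rfl) (fun _ => rfl)
  have e₂₁ := exists_kernelsThrough_klDiv_le_condMutualInfo (jointLaw W P)
    (T := fun ω => (ω.1, ω.2.2.1)) (U := fun ω => ω.2.1) (V := fun ω => (ω.1.1, ω.1.2.2))
    (Z := fun ω => (ω.1.2.1, ω.2.2.1)) (by fun_prop) (by fun_prop) (by fun_prop)
    (f := fun p => (p.1.2.1, p.2)) (by fun_prop)
    (r := fun p => ((p.2.1, p.1.1, p.2.2), p.1.2)) (by fun_prop)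
    (fun _ => rfl) (fun _ => rfl)
  have e₁₂₃ := exists_kernelsThrough_klDiv_le_condMutualInfo (jointLaw W P)
    (T := fun ω => (ω.1, (ω.2.1, ω.2.2.1))) (U := fun ω => ω.2.2.2) (V := fun ω => ω.1.2.2)
    (Z := fun ω => (ω.1.2.1, ω.2.2.1, ω.1.1, ω.2.1)) (by fun_prop) (by fun_prop) (by fun_prop)
    (f := fun p => (p.1.2.1, p.2.2, p.1.1, p.2.1)) (by fun_prop)
    (r := fun p => ((p.1.2.2.1, p.1.1, p.2), (p.1.2.2.2, p.1.2.1))) (by fun_prop)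
    (fun _ => rfl) (fun _ => rfl)
  have e₂₁₃ := exists_kernelsThrough_klDiv_le_condMutualInfo (jointLaw W P)
    (T := fun ω => (ω.1, (ω.2.2.1, ω.2.1))) (U := fun ω => ω.2.2.2) (V := fun ω => ω.1.2.2)
    (Z := fun ω => (ω.1.2.1, ω.2.2.1, ω.1.1, ω.2.1)) (by fun_prop) (by fun_prop) (by fun_prop)
    (f := fun p => (p.1.2.1, p.2.1, p.1.1, p.2.2)) (by fun_prop)
    (r := fun p => ((p.1.2.2.1, p.1.1, p.2), (p.1.2.1, p.1.2.2.2))) (by fun_prop)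
    (fun _ => rfl) (fun _ => rfl)
  obtain ⟨Q₁₂₃, hQ₁₂₃, h₁₂₃⟩ := exists_condDiv_le W P (u := fun y => ((y.1, y.2.1), y.2.2))
    (by fun_prop) (fun _ => isMarkovKernel_of_mem_alternatives₁₂₃)
    (klDiv_compProd_sequential_le _ (by fun_prop) (by fun_prop) (by fun_prop)
      (fun _ => isMarkovKernel_of_mem_sequentialKernels
        fun _ => isMarkovKernel_of_mem_kernelsThrough)
      (klDiv_compProd_sequential_le _ (by fun_prop) (by fun_prop) (by fun_prop)
        (fun _ => isMarkovKernel_of_mem_kernelsThrough) e₁ e₁₂) e₁₂₃)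
  obtain ⟨Q₂₁₃, hQ₂₁₃, h₂₁₃⟩ := exists_condDiv_le W P (u := fun y => ((y.2.1, y.1), y.2.2))
    (by fun_prop) (fun _ => isMarkovKernel_of_mem_alternatives₂₁₃)
    (klDiv_compProd_sequential_le _ (by fun_prop) (by fun_prop) (by fun_prop)
      (fun _ => isMarkovKernel_of_mem_sequentialKernels
        fun _ => isMarkovKernel_of_mem_kernelsThrough)
      (klDiv_compProd_sequential_le _ (by fun_prop) (by fun_prop) (by fun_prop)
        (fun _ => isMarkovKernel_of_mem_kernelsThrough) e₂ e₂₁) e₂₁₃)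
  rw [boundB, ← min_add_add_right]
  refine le_min ?_ ?_ <;>
    refine (ENNReal.mul_le_mul_iff_left log_two_ne_zero ENNReal.ofReal_ne_top).1 ?_ <;>
    simp only [add_mul]
  · exact (h.le₁₂₃ _ hQ₁₂₃).trans h₁₂₃
  · refine (h.le₂₁₃ _ hQ₂₁₃).trans (h₂₁₃.trans (le_of_eq ?_))
    ring

end Main

end CoMS

theorem mainTheorem2 {X₁ X₂ X₃ Y₁ Y₂ Y₃ : Type*}
    [MeasurableSpace X₁] [MeasurableSpace X₂] [MeasurableSpace X₃]
    [MeasurableSpace Y₁] [MeasurableSpace Y₂] [MeasurableSpace Y₃]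
    [StandardBorelSpace X₁] [StandardBorelSpace X₂] [StandardBorelSpace X₃]
    [StandardBorelSpace Y₁] [StandardBorelSpace Y₂] [StandardBorelSpace Y₃]
    [Nonempty X₁] [Nonempty X₂] [Nonempty X₃] [Nonempty Y₁] [Nonempty Y₂] [Nonempty Y₃]
    (W : Kernel (X₁ × X₂ × X₃) (Y₁ × Y₂ × Y₃)) [IsMarkovKernel W] :
    (CoMS.sumCapacity W ≤
        ⨆ P : ProbabilityMeasure (X₁ × X₂ × X₃), min (CoMS.boundA W P) (CoMS.boundB W P)) ∧
      (Finite X₁ → Finite X₂ → Finite X₃ →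
        ∃ P : ProbabilityMeasure (X₁ × X₂ × X₃),
          CoMS.sumCapacity W ≤ min (CoMS.boundA W P) (CoMS.boundB W P)) := by
  refine ⟨le_of_forall_lt_imp_le_of_dense fun b hb => ?_, fun _ _ _ => ?_⟩
  · obtain ⟨P, hP⟩ := CoMS.exists_isDivergenceBound W hb
    exact (le_min hP.le_boundA hP.le_boundB).trans (le_iSup
      (fun P : ProbabilityMeasure (X₁ × X₂ × X₃) => min (CoMS.boundA W P) (CoMS.boundB W P)) P)
  -- A sequence strictly below the sum-capacity exists only if the latter is positive; when it is 0
  -- any input law will do.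
  · obtain h0 | h0 := eq_or_ne (CoMS.sumCapacity W) 0
    · inhabit X₁ × X₂ × X₃
      exact ⟨⟨Measure.dirac default, inferInstance⟩, by simp [h0]⟩
    obtain ⟨b, -, hb, hlim⟩ := exists_seq_strictMono_tendsto' (pos_iff_ne_zero.2 h0)
    choose P hP using fun n => CoMS.exists_isDivergenceBound W (hb n).2
    obtain ⟨P', φ, hφ, hPφ⟩ := CoMS.exists_subseq_tendsto_singleton P
    have hlim' := ENNReal.Tendsto.mul_const (b := ENNReal.ofReal (Real.log 2))
      (hlim.comp hφ.tendsto_atTop) (.inr ENNReal.ofReal_ne_top)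
    have h := CoMS.IsDivergenceBound.of_tendsto W hPφ hlim' fun n => hP (φ n)
    exact ⟨P', le_min h.le_boundA h.le_boundB⟩
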